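/- Let $n,r$ be positive integers, let $S=\mathbb{C}[y_{ij}:1\le i,j\le n]$ be the algebra of polynomial functions on $\mathfrak{gl}_n$ (with generic matrix $Y=[y_{ij}]$), and let $\mathcal{P}=\mathcal{P}(n,r)=\mathbb{C}[x_{i\alpha}:1\le i\le n,\,1\le\alpha\le r]$ be the coordinate ring of the space of complex $n\times r$ matrices, with the $\mathrm{GL}_n$-action $(\tilde L(g)P)(A)=P(g^{T}A)$ and its differential $L(E_{ij})=\sum_{\alpha=1}^{r}x_{i\alpha}\partial_{j\alpha}$, where $\partial_{i\alpha}=\partial/\partial x_{i\alpha}$. Write $X=[x_{i\alpha}]$ and $D=[\partial_{i\alpha}]$. The Kirillov algebra $\mathscr{C}(\mathcal{P})=(S\otimes\operatorname{End}\mathcal{P})^{\mathrm{GL}_n}$ consists of the $F\in S\otimes\operatorname{End}\mathcal{P}$ with $F(gYg^{-1})=\tilde L(g)F(Y)\tilde L(g)^{-1}$ for all $g\in\mathrm{GL}_n$. The Kirillov--Wei operator is $(\mathbf{D}F)(Y)=\sum_{i,j=1}^{n}\frac{\partial F}{\partial y_{ji}}(Y)\cdot L(E_{ij})$. Let $c_k(Y)=\operatorname{tr}(\Lambda^kY)$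 for $0\le k\le n$, regarded as a scalar operator, and for $p,q\ge 0$, $p+q\le n$, let $M_{p,q}=\mathbf{D}^{q}(c_{p+q})$. The big algebra $\mathscr{B}(\mathcal{P}(n,r))$ is the subalgebra of $\mathscr{C}(\mathcal{P})$ generated by the $M_{p,q}$ with $p+q\le n$. For $p,q\ge 0$ with $p+q\le n$ put $$F_{p,q}(Y)=\sum_{\substack{I_1,J_1\in\binom{[n]}{p},\ I_2,J_2\in\binom{[n]}{q}\\ I_1\sqcup I_2=J_1\sqcup J_2}}\operatorname{sgn}\binom{I_1\ I_2}{J_1\ J_2}\,\det Y_{I_1J_1}\sum_{R\in\binom{[r]}{q}}\det(X_{J_2,R})\det(D_{I_2,R}),$$ where $\binom{[m]}{k}$ is the set of $k$-element subsets of $\{1,\dots,m\}$, each viewed as its increasing $k$-tuple, the unions are required to be disjoint, $\operatorname{sgn}\binom{I_1\ I_2}{J_1\ J_2}$ is the sign of the permutation that takes the concatenated tuple $(J_1,J_2)$ to $(I_1,I_2)$, and $\det(X_{J_2,R})$ acts on $\mathcal{P}$ by multiplication. Then: 1. $\mathscr{B}(\mathcal{P}(n,r))$ is generated, as a $\mathbb{C}$-algebra,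 by the operators $F_{p,q}$ with $p,q\ge 0$, $p+q\le n$ (in particular these lie in $\mathscr{C}(\mathcal{P})$); 2. for all $p,q\ge 0$ with $p+q\le n$, $$M_{p,q}=\sum_{\ell=0}^{q}(-1)^{q-\ell}\,(q-\ell)!\;\ell!\,\genfrac\{\}{0pt}{}{q}{\ell}\binom{n-p-\ell}{q-\ell}\,F_{p,\ell},$$ where $\genfrac\{\}{0pt}{}{q}{\ell}$ is the Stirling number of the second kind. -/

import Mathlib

open scoped TensorProduct Nat

noncomputable section

namespace BigAlg

/-! ### Polynomial functions on `gl_n`, and the coordinate ring of `Mat(n, r)` -/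

/-- `S(gl_n^*) = ℂ[y_{ij}]`, the algebra of polynomial functions on `gl_n`. -/
abbrev PolyGL (n : ℕ) : Type := MvPolynomial (Fin n × Fin n) ℂ

/-- `P(n, r) = ℂ[x_{iα}]`, the coordinate ring of the space of `n × r` matrices. -/
abbrev PolyMat (n r : ℕ) : Type := MvPolynomial (Fin n × Fin r) ℂ

/-- The generic matrix `Y = [y_{ij}]`. -/
def genY (n : ℕ) : Matrix (Fin n) (Fin n) (PolyGL n) :=
  Matrix.of fun i j => MvPolynomial.X (i, j)

/-- `c_k(Y) = tr(Λ^k Y)`, as an element of `S(gl_n^*)`. -/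
def c (n k : ℕ) : PolyGL n :=
  LinearMap.trace (PolyGL n) (⋀[PolyGL n]^k (Fin n → PolyGL n))
    (exteriorPower.map k (Matrix.toLin' (genY n)))

/-- The algebra automorphism `f ↦ f ∘ Ad(g)` of `S(gl_n^*)`, i.e. the substitution
`Y ↦ g Y g⁻¹`. -/
def compAd {n : ℕ} (g : GL (Fin n) ℂ) : PolyGL n →ₐ[ℂ] PolyGL n :=
  MvPolynomial.aeval fun ij : Fin n × Fin n =>
    (((g : Matrix (Fin n) (Fin n) ℂ).map MvPolynomial.C * genY n *
      ((g⁻¹ : GL (Fin n) ℂ) : Matrix (Fin n) (Fin n) ℂ).map MvPolynomial.C :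
        Matrix (Fin n) (Fin n) (PolyGL n))) ij.1 ij.2

/-! ### Kirillov algebra, Kirillov--Wei operator and big algebra of a representation -/

section General

variable {n : ℕ} {V : Type*} [AddCommGroup V] [Module ℂ V]

/-- The conjugation `T ↦ ρ(g) T ρ(g)⁻¹` of `End V`. -/
def conjEnd (ρ : Representation ℂ (GL (Fin n) ℂ) V) (g : GL (Fin n) ℂ) :
    Module.End ℂ V →ₐ[ℂ] Module.End ℂ V :=
  AlgHom.ofLinearMap
    ((LinearMap.mulLeft ℂ (ρ g)).comp (LinearMap.mulRight ℂ (ρ g⁻¹)))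
    (by simp [← map_mul])
    (fun S T => by
      have h : ρ g⁻¹ * ρ g = 1 := by simp [← map_mul]
      simp only [LinearMap.comp_apply, LinearMap.mulLeft_apply, LinearMap.mulRight_apply]
      calc ρ g * (S * T * ρ g⁻¹) = ρ g * (S * 1 * T * ρ g⁻¹) := by rw [mul_one]
        _ = ρ g * (S * ρ g⁻¹) * (ρ g * (T * ρ g⁻¹)) := by rw [← h]; simp only [mul_assoc])

/-- The Kirillov algebra `C(V) = (S(gl_n^*) ⊗ End V)^{GL_n}`: the elements `F` with
`F(Ad(g) Y) = ρ(g) F(Y) ρ(g)⁻¹` for all `g ∈ GL_n`. -/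
def kirillovAlgebra (ρ : Representation ℂ (GL (Fin n) ℂ) V) :
    Subalgebra ℂ (PolyGL n ⊗[ℂ] Module.End ℂ V) :=
  ⨅ g : GL (Fin n) ℂ, AlgHom.equalizer
    (Algebra.TensorProduct.map (compAd g) (AlgHom.id ℂ (Module.End ℂ V)))
    (Algebra.TensorProduct.map (AlgHom.id ℂ (PolyGL n)) (conjEnd ρ g))

/-- The Kirillov--Wei operator `(𝐃 F)(Y) = ∑_{i,j} (∂F/∂y_{ji})(Y) · π(E_{ij})`. -/
def kirillovWei (π : Matrix (Fin n) (Fin n) ℂ →ₗ[ℂ] Module.End ℂ V) :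
    Module.End ℂ (PolyGL n ⊗[ℂ] Module.End ℂ V) :=
  ∑ i : Fin n, ∑ j : Fin n,
    TensorProduct.map (MvPolynomial.pderiv (j, i) : Derivation ℂ (PolyGL n) (PolyGL n)).toLinearMap
      (LinearMap.mulRight ℂ (π (Matrix.single i j 1)))

/-- `M_{p,q} = 𝐃^q (c_{p+q})`, where `c_{p+q}` is viewed as a scalar operator. -/
def opM (π : Matrix (Fin n) (Fin n) ℂ →ₗ[ℂ] Module.End ℂ V) (p q : ℕ) :
    PolyGL n ⊗[ℂ] Module.End ℂ V :=
  (kirillovWei π ^ q) (c n (p + q) ⊗ₜ[ℂ] 1)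

/-- The big algebra `B(V)`, generated by the `M_{p,q}` with `p + q ≤ n`. -/
def bigAlgebra (π : Matrix (Fin n) (Fin n) ℂ →ₗ[ℂ] Module.End ℂ V) :
    Subalgebra ℂ (PolyGL n ⊗[ℂ] Module.End ℂ V) :=
  Algebra.adjoin ℂ {M | ∃ p q : ℕ, p + q ≤ n ∧ M = opM π p q}

end General

/-! ### The representation `P(n, r)` -/

/-- The substitution `x_{iα} ↦ ∑_k g_{ki} x_{kα}`, i.e. `P ↦ (A ↦ P(gᵀ A))`. -/
def substT {n : ℕ} (r : ℕ) (g : Matrix (Fin n) (Fin n) ℂ) : PolyMat n r →ₐ[ℂ] PolyMat n r :=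
  MvPolynomial.aeval fun ia : Fin n × Fin r =>
    ∑ k, MvPolynomial.C (g k ia.1) * MvPolynomial.X (k, ia.2)

theorem substT_one (n r : ℕ) : substT r (1 : Matrix (Fin n) (Fin n) ℂ) = AlgHom.id ℂ _ := by
  ext1 ⟨i, a⟩
  simp [substT, Matrix.one_apply]

theorem substT_mul {n r : ℕ} (g h : Matrix (Fin n) (Fin n) ℂ) :
    substT r (g * h) = (substT r g).comp (substT r h) := by
  ext1 ⟨i, a⟩
  simp only [substT, MvPolynomial.aeval_X, AlgHom.comp_apply, map_sum, map_mul,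
    MvPolynomial.algHom_C, MvPolynomial.algebraMap_eq, Matrix.mul_apply, Finset.sum_mul,
    Finset.mul_sum]
  rw [Finset.sum_comm]
  exact Finset.sum_congr rfl fun _ _ => Finset.sum_congr rfl fun _ _ => by ring

/-- `(substT g P)(A) = P(gᵀ A)`. -/
theorem eval_substT {n r : ℕ} (g : Matrix (Fin n) (Fin n) ℂ) (P : PolyMat n r)
    (A : Matrix (Fin n) (Fin r) ℂ) :
    MvPolynomial.eval (fun ia => A ia.1 ia.2) (substT r g P) =
      MvPolynomial.eval (fun ia => (g.transpose * A) ia.1 ia.2) P := by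
  induction P using MvPolynomial.induction_on with
  | C z => simp [substT]
  | add p q hp hq => simp [hp, hq]
  | mul_X p ia hp =>
    rw [map_mul, map_mul, map_mul, hp]
    simp [substT, Matrix.mul_apply]

/-- The `GL_n`-action on `P(n, r)`: `(g · P)(A) = P(gᵀ A)`. -/
def repGL (n r : ℕ) : Representation ℂ (GL (Fin n) ℂ) (PolyMat n r) where
  toFun g := (substT r (g : Matrix (Fin n) (Fin n) ℂ)).toLinearMap
  map_one' := by
    rw [Units.val_one, substT_one]; rfl
  map_mul' g h := by
    rw [Units.val_mul, substT_mul]; rfl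

/-- The operator of multiplication by `x_{iα}` on `P(n, r)`. -/
def opX (n r : ℕ) : Matrix (Fin n) (Fin r) (Module.End ℂ (PolyMat n r)) :=
  Matrix.of fun i a => LinearMap.mulLeft ℂ (MvPolynomial.X (i, a))

/-- The operator `∂_{iα} = ∂/∂x_{iα}` on `P(n, r)`. -/
def opD (n r : ℕ) : Matrix (Fin n) (Fin r) (Module.End ℂ (PolyMat n r)) :=
  Matrix.of fun i a =>
    (MvPolynomial.pderiv (i, a) : Derivation ℂ (PolyMat n r) (PolyMat n r)).toLinearMap

/-- The infinitesimal `gl_n`-action on `P(n, r)`: `L(E_{ij}) = ∑_α x_{iα} ∂_{jα}`, extended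
linearly. It is the differential of `repGL`, see `hasDerivAt_repGL`. -/
def repL (n r : ℕ) : Matrix (Fin n) (Fin n) ℂ →ₗ[ℂ] Module.End ℂ (PolyMat n r) where
  toFun Z := ∑ i, ∑ j, Z i j • ∑ a, opX n r i a * opD n r j a
  map_add' Z W := by simp [add_smul, Finset.sum_add_distrib]
  map_smul' z Z := by simp [mul_smul, Finset.smul_sum]

theorem repL_single (n r : ℕ) (i j : Fin n) :
    repL n r (Matrix.single i j 1) = ∑ a, opX n r i a * opD n r j a := by
  simp only [repL, LinearMap.coe_mk, AddHom.coe_mk, Matrix.single_apply]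
  rw [Finset.sum_eq_single i, Finset.sum_eq_single j] <;> simp +contextual [eq_comm]

theorem repL_apply_mul {n r : ℕ} (Z : Matrix (Fin n) (Fin n) ℂ) (P Q : PolyMat n r) :
    repL n r Z (P * Q) = P * repL n r Z Q + Q * repL n r Z P := by
  simp only [repL, opX, opD, LinearMap.coe_mk, AddHom.coe_mk, LinearMap.sum_apply,
    LinearMap.smul_apply, Module.End.mul_apply, Matrix.of_apply, LinearMap.mulLeft_apply,
    Derivation.coeFn_coe, Derivation.leibniz, smul_eq_mul, Finset.mul_sum,
    ← Finset.sum_add_distrib, Finset.smul_sum]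
  refine Finset.sum_congr rfl fun i _ => Finset.sum_congr rfl fun j _ =>
    Finset.sum_congr rfl fun a _ => ?_
  simp only [MvPolynomial.smul_eq_C_mul]
  ring

theorem repL_apply_X {n r : ℕ} (Z : Matrix (Fin n) (Fin n) ℂ) (k : Fin n) (a : Fin r) :
    repL n r Z (MvPolynomial.X (k, a)) = ∑ i, Z i k • MvPolynomial.X (i, a) := by
  simp only [repL, opX, opD, LinearMap.coe_mk, AddHom.coe_mk, LinearMap.sum_apply,
    LinearMap.smul_apply, Module.End.mul_apply, Matrix.of_apply, LinearMap.mulLeft_apply,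
    Derivation.coeFn_coe, MvPolynomial.pderiv_X]
  refine Finset.sum_congr rfl fun i _ => ?_
  rw [Finset.sum_eq_single k, Finset.sum_eq_single a]
  · simp
  · intro b _ hb
    rw [Pi.single_eq_of_ne (by simp [hb.symm])]; simp
  · simp
  · intro j _ hj
    rw [Finset.sum_eq_zero, smul_zero]
    intro b _
    rw [Pi.single_eq_of_ne (by simp [hj.symm])]; simp
  · simp

theorem repL_apply_C {n r : ℕ} (Z : Matrix (Fin n) (Fin n) ℂ) (z : ℂ) :
    repL n r Z (MvPolynomial.C z) = 0 := by
  simp [repL, opX, opD]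

/-- `repL` is the differential at the identity of the action `repGL`: for every curve `γ` in
`GL_n` with `γ(0) = 1` and velocity `γ'(0) = Z`, the derivative of `γ(t) · P` at `t = 0` is
`repL Z P`. -/
theorem hasDerivAt_repGL {n r : ℕ} (γ : ℂ → GL (Fin n) ℂ) (Z : Matrix (Fin n) (Fin n) ℂ)
    (h0 : γ 0 = 1)
    (hγ : ∀ i j, HasDerivAt (fun t => (γ t : Matrix (Fin n) (Fin n) ℂ) i j) (Z i j) 0)
    (P : PolyMat n r) (A : Fin n × Fin r → ℂ) :
    HasDerivAt (fun t => MvPolynomial.eval A (repGL n r (γ t) P))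
      (MvPolynomial.eval A (repL n r Z P)) 0 := by
  have hrep : ∀ g P, repGL n r g P = substT r (g : Matrix (Fin n) (Fin n) ℂ) P :=
    fun _ _ => rfl
  simp only [hrep]
  induction P using MvPolynomial.induction_on with
  | C z =>
    have h : ∀ g : Matrix (Fin n) (Fin n) ℂ, substT r g (MvPolynomial.C z) = MvPolynomial.C z :=
      fun g => MvPolynomial.algHom_C _ z
    simp only [h, repL_apply_C, map_zero]
    exact hasDerivAt_const (0 : ℂ) _
  | add p q hp hq =>
    simp only [map_add]
    exact hp.fun_add hq
  | mul_X p ka hp =>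
    obtain ⟨k, a⟩ := ka
    have hX : HasDerivAt (fun t => MvPolynomial.eval A (substT r (γ t) (MvPolynomial.X (k, a))))
        (MvPolynomial.eval A (repL n r Z (MvPolynomial.X (k, a)))) 0 := by
      simp only [substT, MvPolynomial.aeval_X, map_sum, map_mul, MvPolynomial.eval_C,
        MvPolynomial.eval_X, repL_apply_X, MvPolynomial.smul_eval]
      exact HasDerivAt.fun_sum fun i _ => (hγ i k).mul_const _
    have h := hp.fun_mul hX
    simp only [h0, Units.val_one, substT_one, AlgHom.id_apply] at h
    simp only [← map_mul] at h
    rw [← map_add] at h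
    have e : repL n r Z p * MvPolynomial.X (k, a) + p * repL n r Z (MvPolynomial.X (k, a)) =
        repL n r Z (p * MvPolynomial.X (k, a)) := by
      rw [repL_apply_mul]; ring
    rw [e] at h
    exact h

/-! ### The operators `F_{p,q}` -/

/-- The set `binom([m], k)` of `k`-element subsets of `[m]`. -/
abbrev Sub (m k : ℕ) : Type := {I : Finset (Fin m) // I.card = k}

/-- A `k`-element subset viewed as the increasing `k`-tuple of its elements. -/
def Sub.tuple {m k : ℕ} (I : Sub m k) : Fin k → Fin m := I.1.orderEmbOfFin I.2

/-- The generalized sign of a pair of `k`-tuples of distinct elements: `sgn(τ)` for the unique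
permutation `τ` with `I = τ · J = J ∘ τ⁻¹` if there is one, and `0` otherwise. -/
def tupleSign {m k : ℕ} (I J : Fin k → Fin m) : ℤ :=
  ∑ τ : Equiv.Perm (Fin k), if I = J ∘ ⇑(τ⁻¹) then ((Equiv.Perm.sign τ : ℤˣ) : ℤ) else 0

/-- The determinant `∑_σ sgn(σ) a_{1σ(1)} ⋯ a_{kσ(k)}` of a matrix over a ring that need not be
commutative (used for matrices with pairwise commuting entries). -/
def rdet {k : ℕ} {R : Type*} [Ring R] (A : Matrix (Fin k) (Fin k) R) : R :=
  ∑ σ : Equiv.Perm (Fin k),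
    ((Equiv.Perm.sign σ : ℤˣ) : ℤ) • (List.ofFn fun i => A i (σ i)).prod

/-- The operators
`F_{p,q}(Y) = ∑ sgn(I₁ I₂ / J₁ J₂) det Y_{I₁J₁} ∑_R det(X_{J₂,R}) det(D_{I₂,R})`,
the outer sum being over `I₁, J₁` of size `p` and `I₂, J₂` of size `q` with
`I₁ ⊔ I₂ = J₁ ⊔ J₂` (disjoint unions). -/
def opF (n r p q : ℕ) : PolyGL n ⊗[ℂ] Module.End ℂ (PolyMat n r) :=
  ∑ I₁ : Sub n p, ∑ J₁ : Sub n p, ∑ I₂ : Sub n q, ∑ J₂ : Sub n q,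
    if Disjoint I₁.1 I₂.1 ∧ Disjoint J₁.1 J₂.1 ∧ I₁.1 ∪ I₂.1 = J₁.1 ∪ J₂.1 then
      tupleSign (Fin.append I₁.tuple I₂.tuple) (Fin.append J₁.tuple J₂.tuple) •
        (((genY n).submatrix I₁.tuple J₁.tuple).det ⊗ₜ[ℂ]
          ∑ R : Sub r q, rdet ((opX n r).submatrix J₂.tuple R.tuple) *
            rdet ((opD n r).submatrix I₂.tuple R.tuple))
    else 0

end BigAlg

end

/-! Let Z = ξ xᵀ, with commuting variables ξ standing for the derivatives. Its (j,i) entry is the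
symbol of L(E_{ij}). Up to the factor p! q!, `opF n r p q` is the normally ordered operator
(multiplications to the left of derivatives) whose symbol is the polarized sum of principal minors
with p slots Y and q slots Z; Cauchy–Binet turns minors of Z into the sum over R. This is
`toOp_symF`.

On symbols, 𝐃 has two terms. The classical one replaces a slot Y by Z. The correction comes from
moving x_{iα} past the derivatives: it differentiates one Y slot and one Z slot. Exchanging column
indices between the two resulting elementary slots produces a minus sign and an identity matrix,
whose contraction yields a scalar (`symbol_recursion`). Dividing by factorials gives
`kirillovWei_opF`: 𝐃 F_{p+1,q} = (q+1) F_{p,q+1} - q(n-p-q) F_{p,q}.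

Since M_{p,q+1} = 𝐃 M_{p+1,q} and M_{p,0} = c_p = F_{p,0}, the coefficients of M in terms of F
satisfy a recursion solved by the Stirling formula (`stirlingCoeff_recursion`, `opM_eq_sum`). For
fixed p this change of family is triangular with diagonal q! ≠ 0, so both families generate the same
algebra. Invariance follows because c_k is conjugation invariant and 𝐃 preserves the Kirillov
algebra (`kirillovWei_mem_kirillovAlgebra`). -/

noncomputable section

namespace BigAlg

/-! ### Polarized sums of principal minors -/

section PolTrace

variable {ι κ m R : Type*} [Fintype ι] [DecidableEq ι] [Fintype κ] [DecidableEq κ] [Fintype m]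
  [CommRing R]

set_option linter.unusedSectionVars false

/-- The polarized sum of principal minors: `∑ sgn(σ) ∏ M_s(i_s, i_{σ s})`, the sum being over all
tuples `i` and all permutations `σ` of the slots. -/
def polTrace (M : ι → Matrix m m R) : R :=
  ∑ i : ι → m, ∑ σ : Equiv.Perm ι,
    ((Equiv.Perm.sign σ : ℤˣ) : ℤ) • ∏ s, M s (i s) (i (σ s))

theorem polTrace_comp_equiv (e : ι ≃ κ) (M : κ → Matrix m m R) :
    polTrace (M ∘ e) = polTrace M := by
  unfold polTrace
  refine Fintype.sum_equiv (e.arrowCongr (Equiv.refl m)) _ _ fun i => ?_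
  refine Fintype.sum_equiv e.permCongr _ _ fun σ => ?_
  rw [Equiv.Perm.sign_permCongr]
  congr 1
  refine Fintype.prod_equiv e _ _ fun s => ?_
  simp

theorem polTrace_update_zero (M : ι → Matrix m m R) (s : ι) :
    polTrace (Function.update M s 0) = 0 := by
  unfold polTrace
  refine Finset.sum_eq_zero fun i _ => Finset.sum_eq_zero fun σ _ => ?_
  rw [Finset.prod_eq_zero (Finset.mem_univ s) (by simp), smul_zero]

omit [Fintype ι] in
theorem derivation_prod {k : Type*} [CommRing k] [Algebra k R] (d : Derivation k R R)
    (S : Finset ι) (f : ι → R) :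
    d (∏ s ∈ S, f s) = ∑ s ∈ S, d (f s) * ∏ t ∈ S.erase s, f t := by
  induction S using Finset.induction_on with
  | empty => simp
  | insert a S ha ih =>
    rw [Finset.prod_insert ha, Derivation.leibniz, ih, Finset.sum_insert ha,
      Finset.erase_insert ha, smul_eq_mul, smul_eq_mul, Finset.mul_sum, add_comm,
      mul_comm (d (f a))]
    congr 1
    refine Finset.sum_congr rfl fun s hs => ?_
    rw [Finset.erase_insert_of_ne (by rintro rfl; exact ha hs), Finset.prod_insert (by simp [ha])]
    ring

theorem derivation_polTrace {k : Type*} [CommRing k] [Algebra k R] (d : Derivation k R R)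
    (M : ι → Matrix m m R) :
    d (polTrace M) = ∑ s, polTrace (Function.update M s ((M s).map d)) := by
  unfold polTrace
  rw [map_sum, Finset.sum_comm]
  refine Finset.sum_congr rfl fun i _ => ?_
  rw [map_sum, Finset.sum_comm]
  refine Finset.sum_congr rfl fun σ _ => ?_
  rw [map_zsmul, derivation_prod, Finset.smul_sum]
  refine Finset.sum_congr rfl fun s _ => ?_
  congr 1
  rw [← Finset.mul_prod_erase _ _ (Finset.mem_univ s)]
  simp only [Function.update_self, Matrix.map_apply]
  congr 1
  refine Finset.prod_congr rfl fun t ht => ?_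
  rw [Function.update_of_ne (Finset.ne_of_mem_erase ht)]

/-- Add a slot with the matrix `A` to the family `M`. -/
def consSlot (A : Matrix m m R) (M : κ → Matrix m m R) : Option κ → Matrix m m R :=
  fun o => o.elim A M

@[simp] theorem consSlot_none (A : Matrix m m R) (M : κ → Matrix m m R) :
    consSlot A M none = A := rfl

@[simp] theorem consSlot_some (A : Matrix m m R) (M : κ → Matrix m m R) (s : κ) :
    consSlot A M (some s) = M s := rfl

theorem update_consSlot_some (A B : Matrix m m R) (M : κ → Matrix m m R) (s : κ) :
    Function.update (consSlot A M) (some s) B = consSlot A (Function.update M s B) := by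
  funext o; cases o with
  | none => simp
  | some t => by_cases h : t = s <;> simp [h, Function.update]

theorem polTrace_consSlot_comp_equiv (A : Matrix m m R) (e : ι ≃ κ) (M : κ → Matrix m m R) :
    polTrace (consSlot A (M ∘ e)) = polTrace (consSlot A M) := by
  rw [← polTrace_comp_equiv e.optionCongr]
  congr 1
  funext o; cases o <;> simp

theorem polTrace_consSlot_comm (A B : Matrix m m R) (M : κ → Matrix m m R) :
    polTrace (consSlot A (consSlot B M)) = polTrace (consSlot B (consSlot A M)) := by
  rw [← polTrace_comp_equiv (Equiv.swap none (some none))]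
  congr 1
  funext o
  rcases o with _ | _ | s <;> simp [Equiv.swap_apply_def]

theorem polTrace_consSlot_eq (A : Matrix m m R) (M : κ → Matrix m m R) :
    polTrace (consSlot A M) = ∑ i : Option κ → m, ∑ σ : Equiv.Perm (Option κ),
      ((Equiv.Perm.sign σ : ℤˣ) : ℤ) •
        (A (i none) (i (σ none)) * ∏ s, M s (i (some s)) (i (σ (some s)))) := by
  simp only [polTrace, Fintype.prod_option, consSlot_none, consSlot_some]

variable [DecidableEq m]

/-- Linearity in the first slot. -/
theorem polTrace_consSlot_eq_sum (A : Matrix m m R) (M : κ → Matrix m m R) :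
    polTrace (consSlot A M) =
      ∑ a, ∑ b, A a b * polTrace (consSlot (Matrix.single a b 1) M) := by
  have h : ∀ c d, A c d = ∑ a, ∑ b, A a b * (Matrix.single a b (1 : R)) c d := by
    intro c d
    simp [Matrix.single_apply, ite_and]
  simp only [polTrace_consSlot_eq]
  simp only [Finset.mul_sum]
  have hc : ∀ f : m → m → (Option κ → m) → Equiv.Perm (Option κ) → R,
      ∑ a, ∑ b, ∑ i, ∑ σ, f a b i σ = ∑ i, ∑ σ, ∑ a, ∑ b, f a b i σ := by
    intro f
    rw [← Fintype.sum_prod_type' (f := fun a b => ∑ i, ∑ σ, f a b i σ), Finset.sum_comm]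
    refine Finset.sum_congr rfl fun i _ => ?_
    rw [Finset.sum_comm]
    exact Finset.sum_congr rfl fun σ _ => Fintype.sum_prod_type' (f := fun a b => f a b i σ)
  rw [hc]
  refine Finset.sum_congr rfl fun i _ => Finset.sum_congr rfl fun σ _ => ?_
  rw [h (i none)]
  simp only [Finset.sum_mul, Finset.smul_sum, mul_smul_comm, mul_assoc]

/-- Contracting a slot filled with the identity matrix. -/
theorem polTrace_consSlot_one (M : κ → Matrix m m R) :
    polTrace (consSlot 1 M) = ((Fintype.card m : R) - Fintype.card κ) * polTrace M := by
  rw [polTrace_consSlot_eq]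
  -- Here σ is written as the swap of `none` with `o`, times a permutation τ of the old slots. The
  -- identity entry forces `i none = i o`, so the swap is invisible to the index tuple.
  have key : ∀ τ : Equiv.Perm κ, ∀ o : Option κ, ∀ i : Option κ → m,
      ((1 : Matrix m m R) (i none) (i (Equiv.Perm.decomposeOption.symm (o, τ) none)) *
        ∏ s, M s (i (some s)) (i (Equiv.Perm.decomposeOption.symm (o, τ) (some s)))) =
      (1 : Matrix m m R) (i none) (i o) * ∏ s, M s (i (some s)) (i (some (τ s))) := by
    intro τ o i
    have h1 : Equiv.Perm.decomposeOption.symm (o, τ) none = o := by simp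
    rw [h1]
    by_cases hi : i none = i o
    · congr 1
      refine Finset.prod_congr rfl fun s _ => ?_
      congr 1
      simp only [Equiv.Perm.decomposeOption_symm_apply, Equiv.Perm.coe_mul, Function.comp_apply,
        Equiv.optionCongr_apply, Option.map_some]
      by_cases ho : some (τ s) = o
      · subst ho; simp [hi]
      · rw [Equiv.swap_apply_of_ne_of_ne (by simp) ho]
    · rw [Matrix.one_apply_ne hi]; simp
  have hs : ∀ i : Option κ → m, (∑ σ : Equiv.Perm (Option κ), ((Equiv.Perm.sign σ : ℤˣ) : ℤ) •
        ((1 : Matrix m m R) (i none) (i (σ none)) *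
          ∏ s, M s (i (some s)) (i (σ (some s))))) =
      ∑ o : Option κ, ∑ τ : Equiv.Perm κ,
        ((Equiv.Perm.sign (Equiv.swap none o) * Equiv.Perm.sign τ : ℤˣ) : ℤ) •
          ((1 : Matrix m m R) (i none) (i o) * ∏ s, M s (i (some s)) (i (some (τ s)))) := by
    intro i
    rw [← Equiv.sum_comp Equiv.Perm.decomposeOption.symm, Fintype.sum_prod_type]
    refine Finset.sum_congr rfl fun o _ => Finset.sum_congr rfl fun τ _ => ?_
    rw [key]
    congr 2
    simp
  rw [Finset.sum_congr rfl fun i _ => hs i]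
  let G : (κ → m) → R := fun i => ∑ τ : Equiv.Perm κ,
    ((Equiv.Perm.sign τ : ℤˣ) : ℤ) • ∏ s, M s (i s) (i (τ s))
  -- The choice `o = none` leaves `i none` free and will contribute `card m`; each `o = some s`
  -- carries the sign of a transposition and pins `i none` to `i (some s)`, contributing -1.
  have hG : ∀ i : Option κ → m, (∑ o : Option κ, ∑ τ : Equiv.Perm κ,
        ((Equiv.Perm.sign (Equiv.swap none o) * Equiv.Perm.sign τ : ℤˣ) : ℤ) •
          ((1 : Matrix m m R) (i none) (i o) * ∏ s, M s (i (some s)) (i (some (τ s))))) =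
      G (fun s => i (some s)) - ∑ s, (1 : Matrix m m R) (i none) (i (some s)) *
        G (fun s => i (some s)) := by
    intro i
    have h1 : ∀ s : κ, Equiv.Perm.sign (Equiv.swap (none : Option κ) (some s)) = -1 :=
      fun s => Equiv.Perm.sign_swap (by simp)
    simp only [Fintype.sum_option, h1, Equiv.swap_self, Equiv.Perm.sign_refl, one_mul,
      Matrix.one_apply_eq, neg_mul, Units.val_neg, neg_smul, Finset.sum_neg_distrib, G,
      Finset.mul_sum, mul_smul_comm, sub_eq_add_neg]
  rw [Finset.sum_congr rfl fun i _ => hG i]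
  have hP : ∀ F : m → (κ → m) → R, ∑ i : Option κ → m, F (i none) (fun s => i (some s)) =
      ∑ i : κ → m, ∑ a, F a i := by
    intro F
    rw [Finset.sum_comm, ← Fintype.sum_prod_type']
    exact Fintype.sum_equiv (Equiv.piOptionEquivProd (β := fun _ => m)) _ _ fun i => rfl
  rw [hP fun a i => G i - ∑ s, (1 : Matrix m m R) a (i s) * G i]
  have hpol : polTrace M = ∑ i, G i := rfl
  rw [hpol, Finset.mul_sum]
  clear_value G
  refine Finset.sum_congr rfl fun i _ => ?_
  rw [Finset.sum_sub_distrib, Finset.sum_comm]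
  simp only [Matrix.one_apply, ite_mul, one_mul, zero_mul, Finset.sum_ite_eq', Finset.mem_univ,
    if_true, Finset.sum_const, Finset.card_univ, nsmul_eq_mul, sub_mul]

/-- Exchanging the column indices of two elementary slots changes the sign. -/
theorem polTrace_single_single (a b c d : m) (M : κ → Matrix m m R) :
    polTrace (consSlot (Matrix.single a b 1) (consSlot (Matrix.single c d 1) M)) =
      -polTrace (consSlot (Matrix.single a d 1) (consSlot (Matrix.single c b 1) M)) := by
  simp only [polTrace_consSlot_eq, Fintype.prod_option, consSlot_none, consSlot_some]
  rw [← Finset.sum_neg_distrib]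
  refine Finset.sum_congr rfl fun i _ => ?_
  rw [← Finset.sum_neg_distrib]
  -- Precomposing σ with the swap of the two elementary slots exchanges their column indices, leaves
  -- the other slots alone and flips the sign.
  refine Fintype.sum_equiv (Equiv.mulRight (Equiv.swap none (some none))) _ _ fun σ => ?_
  have h : (none : Option (Option κ)) ≠ some none := by simp
  have h3 : ∀ s : κ, Equiv.swap none (some none) (some (some s)) = some (some s) :=
    fun s => Equiv.swap_apply_of_ne_of_ne (by simp) (by simp)
  simp only [Equiv.coe_mulRight, Equiv.Perm.sign_mul, Equiv.Perm.sign_swap h, Equiv.Perm.mul_apply,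
    Equiv.swap_apply_left, Equiv.swap_apply_right, h3]
  simp only [mul_neg, mul_one, Units.val_neg, neg_smul, neg_neg]
  congr 1
  rw [← mul_assoc, ← mul_assoc]
  congr 1
  simp only [Matrix.single_apply]
  split_ifs <;> simp_all

/-- Column exchange turns the pair E_{ai}, E_{ib} into E_{ab}, E_{ii}, and the sum of the E_{ii} is
an identity slot that contracts to a scalar. The `+ 1` counts the slot E_{ab}. -/
theorem sum_polTrace_single_single (a b : m) (M : κ → Matrix m m R) :
    ∑ i, polTrace (consSlot (Matrix.single a i 1) (consSlot (Matrix.single i b 1) M)) =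
      -((Fintype.card m : R) - (Fintype.card κ + 1)) *
        polTrace (consSlot (Matrix.single a b 1) M) := by
  have h := polTrace_consSlot_one (consSlot (Matrix.single a b (1 : R)) M)
  rw [polTrace_consSlot_eq_sum, Fintype.card_option] at h
  simp only [Matrix.one_apply, ite_mul, one_mul, zero_mul, Finset.sum_ite_eq, Finset.mem_univ,
    if_true] at h
  simp only [fun i => polTrace_single_single a i i b M,
    fun i => polTrace_consSlot_comm (Matrix.single a b (1 : R)) (Matrix.single i i 1) M,
    Finset.sum_neg_distrib, h]
  push_cast
  ring

/-- Moving a distinguished element out of the left summand. -/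
def optionSumLeft (α β : Type*) : Option α ⊕ β ≃ Option (α ⊕ β) where
  toFun := Sum.elim (fun o => o.map Sum.inl) (fun b => some (Sum.inr b))
  invFun o := o.elim (Sum.inl none) (Sum.map some id)
  left_inv := by rintro ((_ | a) | b) <;> rfl
  right_inv := by rintro (_ | a | b) <;> rfl

/-- Moving a distinguished element out of the right summand. -/
def optionSumRight (α β : Type*) : α ⊕ Option β ≃ Option (α ⊕ β) where
  toFun := Sum.elim (fun a => some (Sum.inl a)) (fun o => o.map Sum.inr)
  invFun o := o.elim (Sum.inr none) (Sum.map id some)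
  left_inv := by rintro (a | (_ | b)) <;> rfl
  right_inv := by rintro (_ | a | b) <;> rfl

/-- `p` slots filled with `A` and `q` slots filled with `B`. -/
def biSlots (p q : ℕ) (A B : Matrix m m R) : Fin p ⊕ Fin q → Matrix m m R :=
  Sum.elim (fun _ => A) (fun _ => B)

/-- Pulling the altered slot to the distinguished place erases its position `s`; this is what makes
all Leibniz terms of one kind equal. -/
theorem update_biSlots_inl (p q : ℕ) (A B C : Matrix m m R) (s : Fin (p + 1)) :
    Function.update (biSlots (p + 1) q A B) (Sum.inl s) C = consSlot C (biSlots p q A B) ∘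
      ((finSuccEquiv' s).sumCongr (Equiv.refl (Fin q))).trans (optionSumLeft _ _) := by
  funext t
  rcases t with t | t
  · induction t using Fin.succAboveCases s with
    | x => simp [optionSumLeft]
    | p t => simp [optionSumLeft, biSlots, Fin.succAbove_ne]
  · simp [optionSumLeft, biSlots]

theorem update_biSlots_inr (p q : ℕ) (A B C : Matrix m m R) (s : Fin (q + 1)) :
    Function.update (biSlots p (q + 1) A B) (Sum.inr s) C = consSlot C (biSlots p q A B) ∘
      ((Equiv.refl (Fin p)).sumCongr (finSuccEquiv' s)).trans (optionSumRight _ _) := by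
  funext t
  rcases t with t | t
  · simp [optionSumRight, biSlots]
  · induction t using Fin.succAboveCases s with
    | x => simp [optionSumRight]
    | p t => simp [optionSumRight, biSlots, Fin.succAbove_ne]

end PolTrace

/-! ### The action of the Kirillov–Wei operator on polarized symbols. -/

section SymbolRecursion

variable {m R k : Type*} [Fintype m] [DecidableEq m] [CommRing R] [CommRing k] [Algebra k R]

theorem polTrace_consSlot_biSlots_right (p q : ℕ) (A B : Matrix m m R) :
    polTrace (consSlot B (biSlots p q A B)) = polTrace (biSlots p (q + 1) A B) := by
  have h := update_biSlots_inr p q A B B 0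
  have h2 : biSlots p (q + 1) A B (Sum.inr 0) = B := rfl
  nth_rewrite 2 [← h2] at h
  rw [Function.update_eq_self] at h
  rw [h, polTrace_comp_equiv]

theorem polTrace_update_biSlots_inl (p q : ℕ) (A B C : Matrix m m R) (s : Fin (p + 1)) :
    polTrace (Function.update (biSlots (p + 1) q A B) (Sum.inl s) C) =
      polTrace (consSlot C (biSlots p q A B)) := by
  rw [update_biSlots_inl, polTrace_comp_equiv]

theorem polTrace_consSlot_update_biSlots_inr (p q : ℕ) (A B C E : Matrix m m R)
    (s : Fin (q + 1)) :
    polTrace (consSlot E (Function.update (biSlots p (q + 1) A B) (Sum.inr s) C)) =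
      polTrace (consSlot E (consSlot C (biSlots p q A B))) := by
  rw [update_biSlots_inr, polTrace_consSlot_comp_equiv]

theorem derivation_polTrace_biSlots (d : Derivation k R R) (p q : ℕ) (A B : Matrix m m R)
    (hB : B.map d = 0) :
    d (polTrace (biSlots (p + 1) q A B)) =
      (p + 1 : R) * polTrace (consSlot (A.map d) (biSlots p q A B)) := by
  rw [derivation_polTrace, Fintype.sum_sum_type]
  have h1 : ∀ s : Fin (p + 1), biSlots (p + 1) q A B (Sum.inl s) = A := fun _ => rfl
  have h2 : ∀ s : Fin q, biSlots (p + 1) q A B (Sum.inr s) = B := fun _ => rfl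
  simp only [h1, h2, hB, polTrace_update_zero, polTrace_update_biSlots_inl, Finset.sum_const_zero,
    add_zero, Finset.sum_const, Finset.card_univ, Fintype.card_fin, nsmul_eq_mul]
  push_cast
  rfl

theorem derivation_polTrace_consSlot_biSlots (d : Derivation k R R) (p q : ℕ)
    (A B E : Matrix m m R) (hA : A.map d = 0) (hE : E.map d = 0) :
    d (polTrace (consSlot E (biSlots p (q + 1) A B))) =
      (q + 1 : R) * polTrace (consSlot E (consSlot (B.map d) (biSlots p q A B))) := by
  rw [derivation_polTrace, Fintype.sum_option, Fintype.sum_sum_type]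
  have h1 : ∀ s : Fin p, biSlots p (q + 1) A B (Sum.inl s) = A := fun _ => rfl
  have h2 : ∀ s : Fin (q + 1), biSlots p (q + 1) A B (Sum.inr s) = B := fun _ => rfl
  have h3 : ∀ s : Fin p, polTrace (consSlot E
      (Function.update (biSlots p (q + 1) A B) (Sum.inl s) 0)) = 0 := by
    intro s
    rw [← update_consSlot_some, polTrace_update_zero]
  simp only [consSlot_none, consSlot_some, h1, h2, hA, hE, polTrace_update_zero,
    update_consSlot_some, h3,
    polTrace_consSlot_update_biSlots_inr, Finset.sum_const_zero,
    zero_add, Finset.sum_const, Finset.card_univ, Fintype.card_fin, nsmul_eq_mul]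
  push_cast
  rfl

omit [DecidableEq m] in
theorem derivation_polTrace_consSlot_biSlots_zero (d : Derivation k R R) (p : ℕ)
    (A B E : Matrix m m R) (hA : A.map d = 0) (hE : E.map d = 0) :
    d (polTrace (consSlot E (biSlots p 0 A B))) = 0 := by
  rw [derivation_polTrace, Fintype.sum_option, Fintype.sum_sum_type]
  have h1 : ∀ s : Fin p, biSlots p 0 A B (Sum.inl s) = A := fun _ => rfl
  simp only [consSlot_none, consSlot_some, h1, hA, hE, polTrace_update_zero]
  simp

variable {c : Type*} [Fintype c]

/-- The Kirillov--Wei operator on symbols of the polarized sums of principal minors. -/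
theorem symbol_recursion (Y : Matrix m m R) (x ξ : Matrix m c R)
    (dy : m → m → Derivation k R R) (dξ : m → c → Derivation k R R)
    (hyY : ∀ j i, Y.map (dy j i) = Matrix.single j i 1)
    (hyZ : ∀ j i, (ξ * x.transpose).map (dy j i) = 0)
    (hξY : ∀ i a, Y.map (dξ i a) = 0)
    (hξZ : ∀ i a, (ξ * x.transpose).map (dξ i a) =
      ∑ l, x l a • Matrix.single i l 1) (p q : ℕ) :
    ∑ i, ∑ j, ∑ a, (dy j i (polTrace (biSlots (p + 1) q Y (ξ * x.transpose))) * (x i a * ξ j a) +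
      dξ i a (dy j i (polTrace (biSlots (p + 1) q Y (ξ * x.transpose)))) * ξ j a) =
    (p + 1 : R) * (polTrace (biSlots p (q + 1) Y (ξ * x.transpose)) -
      q * (Fintype.card m - p - q) * polTrace (biSlots p q Y (ξ * x.transpose))) := by
  set Z := ξ * x.transpose with hZ
  have hZe : ∀ j i, Z j i = ∑ a, ξ j a * x i a := fun j i => by
    simp [hZ, Matrix.mul_apply]
  have hdy : ∀ j i, dy j i (polTrace (biSlots (p + 1) q Y Z)) =
      (p + 1 : R) * polTrace (consSlot (Matrix.single j i 1) (biSlots p q Y Z)) := fun j i => by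
    rw [derivation_polTrace_biSlots _ _ _ _ _ (hyZ j i), hyY]
  have hd : ∀ i a (P : R), dξ i a ((p + 1 : R) * P) = (p + 1 : R) * dξ i a P := fun i a P => by
    have : ((p : R) + 1) = ((p + 1 : ℕ) : R) := by push_cast; rfl
    rw [this, ← nsmul_eq_mul, map_nsmul, nsmul_eq_mul]
  simp only [hdy, hd, Finset.sum_add_distrib]
  -- Classical term: pairing the elementary slots E_{ji} with the entries Z_{ji} rebuilds a full
  -- slot Z by linearity.
  have h1 : ∑ i, ∑ j, ∑ a, (p + 1 : R) *
      polTrace (consSlot (Matrix.single j i 1) (biSlots p q Y Z)) * (x i a * ξ j a) =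
      (p + 1 : R) * polTrace (biSlots p (q + 1) Y Z) := by
    rw [← polTrace_consSlot_biSlots_right, polTrace_consSlot_eq_sum, Finset.sum_comm,
      Finset.mul_sum]
    refine Finset.sum_congr rfl fun j _ => ?_
    rw [Finset.mul_sum]
    refine Finset.sum_congr rfl fun i _ => ?_
    rw [hZe, Finset.sum_mul, Finset.mul_sum]
    exact Finset.sum_congr rfl fun a _ => by ring
  rw [h1]
  have hE : ∀ i a (u v : m), (Matrix.single u v (1 : R)).map (dξ i a) = 0 := by
    intro i a u v
    ext s t
    simp only [Matrix.map_apply, Matrix.single_apply, Matrix.zero_apply]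
    split_ifs <;> simp
  rcases q with _ | q
  · simp [derivation_polTrace_consSlot_biSlots_zero, hξY, hE]
  -- Only the Z slots depend on ξ, and only row i of Z depends on ξ_{ia}, so a second elementary
  -- slot E_{il} appears next to E_{ji}.
  have h2 : ∀ i a j, dξ i a (polTrace (consSlot (Matrix.single j i 1) (biSlots p (q + 1) Y Z))) =
      (q + 1 : R) * ∑ l, x l a * polTrace (consSlot (Matrix.single j i 1)
        (consSlot (Matrix.single i l 1) (biSlots p q Y Z))) := by
    intro i a j
    rw [derivation_polTrace_consSlot_biSlots _ _ _ _ _ _ (hξY i a) (hE i a j i), hξZ]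
    congr 1
    rw [polTrace_consSlot_comm, polTrace_consSlot_eq_sum, Finset.sum_eq_single i]
    · refine Finset.sum_congr rfl fun l _ => ?_
      rw [polTrace_consSlot_comm]
      congr 1
      simp [Matrix.sum_apply, Matrix.single_apply]
    · intro b _ hb
      refine Finset.sum_eq_zero fun l _ => ?_
      simp [Matrix.sum_apply, hb.symm]
    · simp
  -- Summing x_{la} ξ_{ja} over a reassembles Z_{jl}; the shared index i of E_{ji} and E_{il}
  -- remains to be contracted by `sum_polTrace_single_single`.
  have h3 : ∑ i, ∑ j, ∑ a, (p + 1 : R) * dξ i a (polTrace (consSlot (Matrix.single j i 1)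
      (biSlots p (q + 1) Y Z))) * ξ j a =
      (p + 1 : R) * (q + 1 : R) * ∑ j, ∑ l, Z j l * ∑ i, polTrace (consSlot (Matrix.single j i 1)
        (consSlot (Matrix.single i l 1) (biSlots p q Y Z))) := by
    rw [Finset.sum_comm, Finset.mul_sum]
    refine Finset.sum_congr rfl fun j _ => ?_
    simp only [h2, hZe, Finset.mul_sum, Finset.sum_mul]
    rw [Finset.sum_comm, Finset.sum_comm (s := (Finset.univ : Finset m)) (t := Finset.univ (α := m))]
    rw [Finset.sum_comm (s := (Finset.univ : Finset c))]
    refine Finset.sum_congr rfl fun i _ => ?_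
    rw [Finset.sum_comm]
    refine Finset.sum_congr rfl fun l _ => ?_
    exact Finset.sum_congr rfl fun a _ => by ring
  rw [h3]
  simp only [sum_polTrace_single_single, Fintype.card_sum, Fintype.card_fin]
  have h4 : ∑ j, ∑ l, Z j l * (-((Fintype.card m : R) - (((p + q : ℕ) : R) + 1)) *
      polTrace (consSlot (Matrix.single j l 1) (biSlots p q Y Z))) =
      -((Fintype.card m : R) - (((p + q : ℕ) : R) + 1)) * polTrace (biSlots p (q + 1) Y Z) := by
    rw [← polTrace_consSlot_biSlots_right, polTrace_consSlot_eq_sum, Finset.mul_sum]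
    refine Finset.sum_congr rfl fun j _ => ?_
    rw [Finset.mul_sum]
    exact Finset.sum_congr rfl fun l _ => by ring
  rw [h4]
  push_cast
  ring

end SymbolRecursion

/-! ### Normal-ordered symbols -/

section Symbols

variable (n r : ℕ)

/-- The subalgebra of constant coefficient differential operators. -/
def constDiff : Subalgebra ℂ (Module.End ℂ (PolyMat n r)) :=
  Algebra.adjoin ℂ (Set.range fun ia : Fin n × Fin r => opD n r ia.1 ia.2)

theorem opD_apply (i : Fin n) (a : Fin r) (P : PolyMat n r) :
    opD n r i a P = MvPolynomial.pderiv (i, a) P := rfl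

theorem opX_apply (i : Fin n) (a : Fin r) (P : PolyMat n r) :
    opX n r i a P = MvPolynomial.X (i, a) * P := rfl

theorem pderiv_pderiv_comm {σ k : Type*} [CommRing k] (i j : σ) (P : MvPolynomial σ k) :
    MvPolynomial.pderiv i (MvPolynomial.pderiv j P) =
      MvPolynomial.pderiv j (MvPolynomial.pderiv i P) := by
  classical
  have h : ⁅MvPolynomial.pderiv (R := k) i, MvPolynomial.pderiv (R := k) j⁆ = 0 := by
    refine MvPolynomial.derivation_ext fun l => ?_
    rw [Derivation.commutator_apply]
    simp only [MvPolynomial.pderiv_X]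
    by_cases h1 : l = i <;> by_cases h2 : l = j <;> simp [Pi.single_apply, h1, h2, apply_ite]
  have := congrArg (fun d => d P) h
  simpa [Derivation.commutator_apply, sub_eq_zero] using this

/-- `MvPolynomial.aeval` needs a commutative target, which the full endomorphism ring is not;
commuting partial derivatives supply one. -/
instance : CommRing (constDiff n r) :=
  { (inferInstance : Ring (constDiff n r)) with
    mul_comm := by
      have := Algebra.isMulCommutative_adjoin ℂ
        (s := Set.range fun ia : Fin n × Fin r => opD n r ia.1 ia.2) (by
          rintro _ ⟨ia, rfl⟩ _ ⟨jb, rfl⟩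
          exact LinearMap.ext fun P => pderiv_pderiv_comm _ _ P)
      exact this.is_comm.comm }

/-- The constant coefficient differential operator with a given symbol. -/
def diffOp : PolyMat n r →ₐ[ℂ] Module.End ℂ (PolyMat n r) :=
  (constDiff n r).val.comp (MvPolynomial.aeval fun ia : Fin n × Fin r =>
    (⟨opD n r ia.1 ia.2, Algebra.subset_adjoin ⟨ia, rfl⟩⟩ : constDiff n r))

theorem diffOp_X (i : Fin n) (a : Fin r) :
    diffOp n r (MvPolynomial.X (i, a)) = opD n r i a := by
  simp [diffOp]

/-- The operator of multiplication by a polynomial. -/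
def mulOp : PolyMat n r →ₐ[ℂ] Module.End ℂ (PolyMat n r) := Algebra.lmul ℂ (PolyMat n r)

theorem mulOp_X (i : Fin n) (a : Fin r) :
    mulOp n r (MvPolynomial.X (i, a)) = opX n r i a := rfl

theorem opD_mul_opX (i j : Fin n) (a b : Fin r) :
    opD n r i a * opX n r j b =
      opX n r j b * opD n r i a + if i = j ∧ a = b then 1 else 0 := by
  refine LinearMap.ext fun P => ?_
  simp only [Module.End.mul_apply, opD_apply, opX_apply, Derivation.leibniz, LinearMap.add_apply,
    MvPolynomial.pderiv_X, smul_eq_mul, Pi.single_apply, Prod.mk.injEq]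
  by_cases h : i = j ∧ a = b
  · simp [h]
  · have h' : ¬ (j = i ∧ b = a) := fun h2 => h ⟨h2.1.symm, h2.2.symm⟩
    simp [h, h']

/-- The canonical commutation relation extended to all constant coefficient operators: commuting
with x_{iα} differentiates the symbol in ξ_{iα}. All quantum corrections originate here. -/
theorem diffOp_mul_opX (d : PolyMat n r) (i : Fin n) (a : Fin r) :
    diffOp n r d * opX n r i a =
      opX n r i a * diffOp n r d + diffOp n r (MvPolynomial.pderiv (i, a) d) := by
  induction d using MvPolynomial.induction_on with
  | C z =>
    have : diffOp n r (MvPolynomial.C z) = algebraMap ℂ _ z := (diffOp n r).commutes z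
    rw [this, MvPolynomial.pderiv_C, map_zero, add_zero, Algebra.commutes]
  | add p q hp hq => simp only [map_add, add_mul, mul_add, hp, hq]; abel
  | mul_X p jb hp =>
    obtain ⟨j, b⟩ := jb
    rw [map_mul, diffOp_X, mul_assoc, opD_mul_opX, mul_add, ← mul_assoc, hp, Derivation.leibniz,
      map_add, smul_eq_mul, smul_eq_mul, mul_comm (MvPolynomial.X (j, b)), map_mul, map_mul,
      diffOp_X, MvPolynomial.pderiv_X, add_mul, mul_assoc, add_assoc]
    congr 1
    rw [add_comm]
    congr 2
    by_cases h : j = i ∧ b = a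
    · simp [h]
    · have h' : ¬ ((j, b) = (i, a)) := by simpa using h
      simp [h, h']

/-- The ring of symbols: polynomials in the `y_{ij}`, `x_{iα}` and `ξ_{iα}`. -/
abbrev Symb : Type :=
  MvPolynomial ((Fin n × Fin n) ⊕ ((Fin n × Fin r) ⊕ (Fin n × Fin r))) ℂ

/-- The inclusion of the polynomials in `y`. -/
def symY : PolyGL n →ₐ[ℂ] Symb n r := MvPolynomial.rename Sum.inl

/-- The inclusion of the polynomials in `x`. -/
def symX : PolyMat n r →ₐ[ℂ] Symb n r := MvPolynomial.rename (Sum.inr ∘ Sum.inl)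

/-- The inclusion of the polynomials in `ξ`. -/
def symXi : PolyMat n r →ₐ[ℂ] Symb n r := MvPolynomial.rename (Sum.inr ∘ Sum.inr)

theorem symY_X (ij) : symY n r (MvPolynomial.X ij) = MvPolynomial.X (Sum.inl ij) := by
  simp [symY]

theorem symX_X (ij) : symX n r (MvPolynomial.X ij) = MvPolynomial.X (Sum.inr (Sum.inl ij)) := by
  simp [symX]

theorem symXi_X (ij) :
    symXi n r (MvPolynomial.X ij) = MvPolynomial.X (Sum.inr (Sum.inr ij)) := by
  simp [symXi]

/-- Separation of the three families of variables. -/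
def symbSplit : Symb n r →ₐ[ℂ] PolyGL n ⊗[ℂ] (PolyMat n r ⊗[ℂ] PolyMat n r) :=
  MvPolynomial.aeval (Sum.elim (fun ij => (MvPolynomial.X ij : PolyGL n) ⊗ₜ[ℂ] 1)
    (Sum.elim (fun ia => 1 ⊗ₜ[ℂ] ((MvPolynomial.X ia : PolyMat n r) ⊗ₜ[ℂ] 1))
      (fun ia => 1 ⊗ₜ[ℂ] (1 ⊗ₜ[ℂ] (MvPolynomial.X ia : PolyMat n r)))))

theorem symbSplit_symY (s : PolyGL n) : symbSplit n r (symY n r s) = s ⊗ₜ 1 := by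
  have : (symbSplit n r).comp (symY n r) = Algebra.TensorProduct.includeLeft := by
    ext1 ij
    simp [symbSplit, symY]
  exact DFunLike.congr_fun this s

theorem symbSplit_symX (p : PolyMat n r) : symbSplit n r (symX n r p) = 1 ⊗ₜ (p ⊗ₜ 1) := by
  have : (symbSplit n r).comp (symX n r) =
      Algebra.TensorProduct.includeRight.comp Algebra.TensorProduct.includeLeft := by
    ext1 ij
    simp [symbSplit, symX]
  exact DFunLike.congr_fun this p

theorem symbSplit_symXi (p : PolyMat n r) : symbSplit n r (symXi n r p) = 1 ⊗ₜ (1 ⊗ₜ p) := by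
  have : (symbSplit n r).comp (symXi n r) =
      Algebra.TensorProduct.includeRight.comp Algebra.TensorProduct.includeRight := by
    ext1 ij
    simp [symbSplit, symXi]
  exact DFunLike.congr_fun this p

/-- Symbols are sums of products of polynomials in the separate families of variables. -/
theorem symb_induction {C : Symb n r → Prop} (w : Symb n r) (zero : C 0)
    (add : ∀ v w, C v → C w → C (v + w))
    (prod : ∀ s p d, C (symY n r s * (symX n r p * symXi n r d))) : C w := by
  -- Multiplying the three tensor factors back together inverts `symbSplit` on the left, so tensor
  -- induction on `symbSplit n r w` suffices.
  let ψ : PolyGL n ⊗[ℂ] (PolyMat n r ⊗[ℂ] PolyMat n r) →ₐ[ℂ] Symb n r :=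
    Algebra.TensorProduct.productMap (symY n r)
      (Algebra.TensorProduct.productMap (symX n r) (symXi n r))
  have hψ : ψ.comp (symbSplit n r) = AlgHom.id ℂ _ := by
    ext1 v
    rcases v with v | v | v <;> simp [symbSplit, ψ, symY_X, symX_X, symXi_X]
  have hw : ψ (symbSplit n r w) = w := DFunLike.congr_fun hψ w
  rw [← hw]
  generalize symbSplit n r w = t
  induction t using TensorProduct.induction_on with
  | zero => simpa using zero
  | add a b ha hb => rw [map_add]; exact add _ _ ha hb
  | tmul s t =>
    induction t using TensorProduct.induction_on with
    | zero => simpa using zero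
    | add a b ha hb => rw [TensorProduct.tmul_add, map_add]; exact add _ _ ha hb
    | tmul p d => simpa [ψ] using prod s p d

/-- The operator with a given normal-ordered symbol. -/
def toOp : Symb n r →ₗ[ℂ] PolyGL n ⊗[ℂ] Module.End ℂ (PolyMat n r) :=
  (TensorProduct.map LinearMap.id (TensorProduct.lift
    ((LinearMap.mul ℂ (Module.End ℂ (PolyMat n r))).compl₁₂ (mulOp n r).toLinearMap
      (diffOp n r).toLinearMap))).comp (symbSplit n r).toLinearMap

theorem toOp_prod (s : PolyGL n) (p d : PolyMat n r) :
    toOp n r (symY n r s * (symX n r p * symXi n r d)) =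
      s ⊗ₜ (mulOp n r p * diffOp n r d) := by
  simp [toOp, symbSplit_symY, symbSplit_symX, symbSplit_symXi]

theorem pderiv_rename_of_notMem {σ τ k : Type*} [CommRing k] (f : σ → τ) (t : τ)
    (h : ∀ s, f s ≠ t) (p : MvPolynomial σ k) :
    MvPolynomial.pderiv t (MvPolynomial.rename f p) = 0 := by
  classical
  refine MvPolynomial.pderiv_eq_zero_of_notMem_vars fun ht => ?_
  obtain ⟨s, _, hs⟩ := Finset.mem_image.mp (MvPolynomial.vars_rename f p ht)
  exact h s hs

theorem pderiv_inl_prod (ij) (s : PolyGL n) (p d : PolyMat n r) :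
    MvPolynomial.pderiv (Sum.inl ij) (symY n r s * (symX n r p * symXi n r d)) =
      symY n r (MvPolynomial.pderiv ij s) * (symX n r p * symXi n r d) := by
  simp only [Derivation.leibniz, smul_eq_mul]
  simp only [symY, symX, symXi, MvPolynomial.pderiv_rename Sum.inl_injective]
  rw [pderiv_rename_of_notMem _ _ (by simp), pderiv_rename_of_notMem _ _ (by simp)]
  ring

theorem pderiv_xi_prod (ia) (s : PolyGL n) (p d : PolyMat n r) :
    MvPolynomial.pderiv (Sum.inr (Sum.inr ia)) (symY n r s * (symX n r p * symXi n r d)) =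
      symY n r s * (symX n r p * symXi n r (MvPolynomial.pderiv ia d)) := by
  have h : MvPolynomial.pderiv (Sum.inr (Sum.inr ia)) (symXi n r d) =
      symXi n r (MvPolynomial.pderiv ia d) :=
    MvPolynomial.pderiv_rename (f := Sum.inr ∘ Sum.inr)
      (Sum.inr_injective.comp Sum.inr_injective) ia d
  simp only [Derivation.leibniz, smul_eq_mul, h]
  simp only [symY, symX, symXi]
  rw [pderiv_rename_of_notMem _ _ (by simp), pderiv_rename_of_notMem _ _ (by simp)]
  ring

theorem toOp_pderiv_inl (ij) (w : Symb n r) :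
    toOp n r (MvPolynomial.pderiv (Sum.inl ij) w) =
      TensorProduct.map (MvPolynomial.pderiv ij : Derivation ℂ (PolyGL n) (PolyGL n)).toLinearMap
        LinearMap.id (toOp n r w) := by
  induction w using symb_induction with
  | zero => simp
  | add v w hv hw => simp only [map_add, hv, hw]
  | prod s p d => rw [pderiv_inl_prod, toOp_prod, toOp_prod]; simp

/-- A factor x on the right must be carried past the derivatives to restore normal order, whence the
ξ-derivative. A factor ∂ on the right is already in place, so `toOp_mul_opD` has no correction. -/
theorem toOp_mul_opX (i : Fin n) (a : Fin r) (w : Symb n r) :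
    toOp n r w * (1 ⊗ₜ opX n r i a) =
      toOp n r (w * symX n r (MvPolynomial.X (i, a)) +
        MvPolynomial.pderiv (Sum.inr (Sum.inr (i, a))) w) := by
  induction w using symb_induction with
  | zero => simp
  | add v w hv hw => simp only [map_add, add_mul, hv, hw]; abel
  | prod s p d =>
    have h : symY n r s * (symX n r p * symXi n r d) * symX n r (MvPolynomial.X (i, a)) =
        symY n r s * (symX n r (p * MvPolynomial.X (i, a)) * symXi n r d) := by
      rw [map_mul]; ring
    rw [pderiv_xi_prod, h, map_add, toOp_prod, toOp_prod, toOp_prod,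
      Algebra.TensorProduct.tmul_mul_tmul, mul_one, mul_assoc, diffOp_mul_opX, mul_add,
      TensorProduct.tmul_add, map_mul, mulOp_X, mul_assoc]

theorem toOp_mul_opD (i : Fin n) (a : Fin r) (w : Symb n r) :
    toOp n r w * (1 ⊗ₜ opD n r i a) = toOp n r (w * symXi n r (MvPolynomial.X (i, a))) := by
  induction w using symb_induction with
  | zero => simp
  | add v w hv hw => rw [map_add, add_mul, hv, hw, ← map_add, add_mul]
  | prod s p d =>
    have h : symY n r s * (symX n r p * symXi n r d) * symXi n r (MvPolynomial.X (i, a)) =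
        symY n r s * (symX n r p * symXi n r (d * MvPolynomial.X (i, a))) := by
      rw [map_mul (symXi n r)]; ring
    rw [h, toOp_prod, toOp_prod,
      Algebra.TensorProduct.tmul_mul_tmul, mul_one, mul_assoc, map_mul, diffOp_X]

/-- The generic matrices of the symbol ring. -/
def matY : Matrix (Fin n) (Fin n) (Symb n r) := (genY n).map (symY n r)

/-- The matrix `[x_{iα}]` over the symbol ring. -/
def matX : Matrix (Fin n) (Fin r) (Symb n r) :=
  Matrix.of fun i a => symX n r (MvPolynomial.X (i, a))

/-- The matrix `[ξ_{iα}]` over the symbol ring. -/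
def matXi : Matrix (Fin n) (Fin r) (Symb n r) :=
  Matrix.of fun i a => symXi n r (MvPolynomial.X (i, a))

/-- The Kirillov--Wei operator in terms of symbols. -/
theorem kirillovWei_toOp (w : Symb n r) :
    kirillovWei (repL n r) (toOp n r w) = toOp n r (∑ i, ∑ j, ∑ a,
      (MvPolynomial.pderiv (Sum.inl (j, i)) w * (matX n r i a * matXi n r j a) +
        MvPolynomial.pderiv (Sum.inr (Sum.inr (i, a))) (MvPolynomial.pderiv (Sum.inl (j, i)) w) *
          matXi n r j a)) := by
  have hR : ∀ (T : Module.End ℂ (PolyMat n r)) (D : PolyGL n →ₗ[ℂ] PolyGL n)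
      (F : PolyGL n ⊗[ℂ] Module.End ℂ (PolyMat n r)),
      TensorProduct.map D (LinearMap.mulRight ℂ T) F =
        TensorProduct.map D LinearMap.id F * (1 ⊗ₜ T) := by
    intro T D F
    induction F using TensorProduct.induction_on with
    | zero => simp
    | add a b ha hb => simp only [map_add, ha, hb, add_mul]
    | tmul s t => simp
  simp only [kirillovWei, LinearMap.sum_apply, map_sum, hR, ← toOp_pderiv_inl, repL_single,
    TensorProduct.tmul_sum, Finset.mul_sum]
  refine Finset.sum_congr rfl fun i _ => Finset.sum_congr rfl fun j _ =>
    Finset.sum_congr rfl fun a _ => ?_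
  have h : (1 : PolyGL n) ⊗ₜ[ℂ] (opX n r i a * opD n r j a) =
      (1 ⊗ₜ opX n r i a) * (1 ⊗ₜ opD n r j a) := by simp
  rw [h, ← mul_assoc, toOp_mul_opX, toOp_mul_opD, add_mul, mul_assoc]
  rfl

/-- The symbol of a multiple of `F_{p,q}`. -/
def symF (p q : ℕ) : Symb n r :=
  polTrace (biSlots p q (matY n r) (matXi n r * (matX n r).transpose))

/-- An instance of `symbol_recursion`; the side goals say that Y depends only on y, and ξxᵀ on ξ but
not on y. -/
theorem kirillovWei_symF (p q : ℕ) :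
    kirillovWei (repL n r) (toOp n r (symF n r (p + 1) q)) =
      (p + 1 : ℂ) • (toOp n r (symF n r p (q + 1)) +
        (-(q * (n - p - q)) : ℂ) • toOp n r (symF n r p q)) := by
  rw [kirillovWei_toOp]
  have key := symbol_recursion (matY n r) (matX n r) (matXi n r)
    (fun j i => MvPolynomial.pderiv (Sum.inl (j, i)))
    (fun i a => MvPolynomial.pderiv (Sum.inr (Sum.inr (i, a)))) ?_ ?_ ?_ ?_ p q
  · unfold symF
    rw [key]
    rw [← map_smul, ← map_add, ← map_smul]
    congr 1
    rw [Fintype.card_fin, Algebra.smul_def, Algebra.smul_def]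
    simp [sub_eq_add_neg]
  · intro j i
    ext u v
    by_cases h : j = u ∧ i = v
    · obtain ⟨rfl, rfl⟩ := h
      simp [matY, genY, symY_X]
    · have h' : ¬ ((u, v) = (j, i)) := fun e => h (by simpa [eq_comm] using e)
      simp [matY, genY, symY_X, h, MvPolynomial.pderiv_X, h']
  · intro j i
    ext u v
    simp [matX, matXi, Matrix.mul_apply, symX_X, symXi_X, MvPolynomial.pderiv_X]
  · intro i a
    ext u v
    simp [matY, genY, symY_X, MvPolynomial.pderiv_X]
  · intro i a
    ext u v
    simp only [matX, matXi, Matrix.mul_apply, symX_X, symXi_X, Matrix.map_apply,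
      Matrix.transpose_apply, Matrix.of_apply, map_sum, Derivation.leibniz, MvPolynomial.pderiv_X,
      smul_eq_mul, Matrix.sum_apply, Matrix.smul_apply, Matrix.single_apply]
    by_cases h : i = u
    · subst h
      simp [Pi.single_apply]
    · simp [h, Ne.symm h]

end Symbols

/-! ### Sums over tuples and sums over subsets -/

section Tuples

theorem Sub.tuple_injective {m k : ℕ} (I : Sub m k) : Function.Injective I.tuple :=
  (I.1.orderEmbOfFin I.2).injective

theorem Sub.range_tuple {m k : ℕ} (I : Sub m k) : Set.range I.tuple = (I.1 : Set (Fin m)) :=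
  Finset.range_orderEmbOfFin I.1 I.2

/-- A sum over tuples that is supported on injective tuples is a sum over subsets and
permutations. -/
theorem sum_tuples_eq {m k : ℕ} {M : Type*} [AddCommMonoid M] (h : (Fin k → Fin m) → M)
    (h0 : ∀ u, ¬ Function.Injective u → h u = 0) :
    ∑ u, h u = ∑ I : Sub m k, ∑ σ : Equiv.Perm (Fin k), h (I.tuple ∘ σ) := by
  rw [← Fintype.sum_prod_type' (f := fun (I : Sub m k) (σ : Equiv.Perm (Fin k)) => h (I.tuple ∘ σ))]
  symm
  -- An injective tuple is, in exactly one way, a reordering of the increasing enumeration of its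
  -- range.
  refine Finset.sum_of_injOn (fun x : Sub m k × Equiv.Perm (Fin k) => x.1.tuple ∘ x.2) ?_
    (by simp) ?_ (fun _ _ => rfl)
  · rintro ⟨I, σ⟩ - ⟨J, τ⟩ - hIJ
    have hIJ' : I.tuple ∘ σ = J.tuple ∘ τ := hIJ
    have hr : I = J := by
      have := congrArg Set.range hIJ'
      rw [σ.surjective.range_comp, τ.surjective.range_comp, I.range_tuple, J.range_tuple] at this
      exact Subtype.ext (Finset.coe_injective this)
    subst hr
    have : σ = τ := Equiv.ext fun s => I.tuple_injective (congrFun hIJ' s)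
    rw [this]
  · intro u _ hu
    refine h0 u fun hinj => hu ?_
    let I : Sub m k := ⟨Finset.univ.image u, by
      rw [Finset.card_image_of_injective _ hinj, Finset.card_univ, Fintype.card_fin]⟩
    have hmem : ∀ s, ∃ t, I.tuple t = u s := fun s => by
      have : u s ∈ Set.range I.tuple := by
        rw [I.range_tuple]
        simp [I]
      exact this
    choose f hf using hmem
    have hfi : Function.Injective f := fun s t hst => hinj (by rw [← hf, ← hf, hst])
    refine ⟨(I, Equiv.ofBijective f (Finite.injective_iff_bijective.mp hfi)), by simp, ?_⟩
    funext s
    exact hf s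

/-- The **Cauchy–Binet formula**. -/
theorem det_mul_eq_sum_subsets {q r : ℕ} {R : Type*} [CommRing R]
    (A : Matrix (Fin q) (Fin r) R) (B : Matrix (Fin r) (Fin q) R) :
    (A * B).det = ∑ K : Sub r q, (A.submatrix id K.tuple).det * (B.submatrix K.tuple id).det := by
  have h1 : (A * B).det =
      ∑ u : Fin q → Fin r, (∏ s, B (u s) s) * (A.submatrix id u).det := by
    simp only [Matrix.det_apply', Matrix.mul_apply, Finset.prod_univ_sum, Finset.mul_sum,
      Fintype.piFinset_univ]
    rw [Finset.sum_comm]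
    refine Finset.sum_congr rfl fun u _ => Finset.sum_congr rfl fun σ _ => ?_
    simp only [Finset.prod_mul_distrib, Matrix.submatrix_apply, id]
    ring
  rw [h1, sum_tuples_eq]
  · refine Finset.sum_congr rfl fun K _ => ?_
    rw [Matrix.det_apply' (B.submatrix K.tuple id), Finset.mul_sum]
    refine Finset.sum_congr rfl fun σ _ => ?_
    have : (A.submatrix id (K.tuple ∘ σ)).det =
        ((Equiv.Perm.sign σ : ℤˣ) : ℤ) * (A.submatrix id K.tuple).det :=
      Matrix.det_permute' σ (A.submatrix id K.tuple)
    rw [this]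
    simp only [Function.comp_apply, Matrix.submatrix_apply, id]
    ring
  · intro u hu
    simp only [Function.Injective, not_forall] at hu
    obtain ⟨s, t, hst, hne⟩ := hu
    rw [Matrix.det_zero_of_column_eq hne (fun i => by simp [hst]), mul_zero]

/-- A sum over pairs of tuples of a function that alternates in both is a sum over pairs of
subsets. -/
theorem sum_tuples_prod_eq {m k : ℕ} {R : Type*} [CommRing R] (A : Matrix (Fin m) (Fin m) R)
    (G : (Fin k → Fin m) → (Fin k → Fin m) → R)
    (hl : ∀ u v (σ : Equiv.Perm (Fin k)), G (u ∘ ⇑σ) v = ((Equiv.Perm.sign σ : ℤˣ) : ℤ) * G u v)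
    (hr : ∀ u v (σ : Equiv.Perm (Fin k)), G u (v ∘ ⇑σ) = ((Equiv.Perm.sign σ : ℤˣ) : ℤ) * G u v)
    (hl0 : ∀ u v, ¬ Function.Injective u → G u v = 0)
    (hr0 : ∀ u v, ¬ Function.Injective v → G u v = 0) :
    ∑ u, ∑ v, G u v * ∏ s, A (u s) (v s) =
      (k ! : R) * ∑ I : Sub m k, ∑ J : Sub m k, G I.tuple J.tuple *
        (A.submatrix I.tuple J.tuple).det := by
  rw [sum_tuples_eq, Finset.mul_sum]
  swap
  · intro u hu
    exact Finset.sum_eq_zero fun v _ => by rw [hl0 u v hu, zero_mul]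
  refine Finset.sum_congr rfl fun I _ => ?_
  -- The right-hand side does not involve σ: the sign from `G` cancels the one from permuting the
  -- rows of the minor. The k! orderings of `I` therefore contribute equally.
  have h2 : ∀ σ : Equiv.Perm (Fin k),
      ∑ v, G (I.tuple ∘ σ) v * ∏ s, A ((I.tuple ∘ σ) s) (v s) =
      ∑ J : Sub m k, G I.tuple J.tuple * (A.submatrix I.tuple J.tuple).det := by
    intro σ
    rw [sum_tuples_eq]
    swap
    · intro v hv
      rw [hr0 _ v hv, zero_mul]
    refine Finset.sum_congr rfl fun J _ => ?_
    have hd : (A.submatrix I.tuple J.tuple).det =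
        ∑ τ : Equiv.Perm (Fin k), ((Equiv.Perm.sign σ : ℤˣ) : ℤ) *
          (((Equiv.Perm.sign τ : ℤˣ) : ℤ) * ∏ s, A (I.tuple (σ s)) (J.tuple (τ s))) := by
      rw [← Finset.mul_sum]
      have h := Matrix.det_permute σ (A.submatrix I.tuple J.tuple)
      rw [← Matrix.det_transpose, Matrix.det_apply'] at h
      have h' : ((Equiv.Perm.sign σ : ℤˣ) : ℤ) * ((Equiv.Perm.sign σ : ℤˣ) : ℤ) = (1 : ℤ) := by
        rw [← Units.val_mul, Int.units_mul_self, Units.val_one]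
      have h'' : (((Equiv.Perm.sign σ : ℤˣ) : ℤ) : R) * ((Equiv.Perm.sign σ : ℤˣ) : ℤ) = 1 := by
        exact_mod_cast congrArg (Int.cast : ℤ → R) h'
      simp only [Matrix.transpose_apply, Matrix.submatrix_apply, id] at h
      rw [h, ← mul_assoc, h'', one_mul]
    rw [hd, Finset.mul_sum]
    refine Finset.sum_congr rfl fun τ _ => ?_
    rw [hl, hr]
    simp only [Function.comp_apply]
    ring
  rw [Finset.sum_congr rfl fun σ _ => h2 σ, Finset.sum_const, Finset.card_univ,
    Fintype.card_perm, Fintype.card_fin, nsmul_eq_mul]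

theorem tupleSign_comp_left {m k : ℕ} (I J : Fin k → Fin m) (α : Equiv.Perm (Fin k)) :
    tupleSign (I ∘ α) J = ((Equiv.Perm.sign α : ℤˣ) : ℤ) * tupleSign I J := by
  unfold tupleSign
  rw [Finset.mul_sum]
  refine Fintype.sum_equiv (Equiv.mulLeft α) _ _ fun τ => ?_
  have h : (I ∘ α = J ∘ ⇑τ⁻¹) ↔ I = J ∘ ⇑((Equiv.mulLeft α) τ)⁻¹ := by
    rw [Equiv.coe_mulLeft, mul_inv_rev, Equiv.Perm.coe_mul, ← Function.comp_assoc]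
    constructor
    · intro h
      rw [← h]
      funext s
      simp
    · intro h
      rw [h]
      funext s
      simp
  simp only [h]
  split_ifs
  · rw [Equiv.coe_mulLeft, Equiv.Perm.sign_mul, Units.val_mul, ← mul_assoc, ← Units.val_mul,
      Int.units_mul_self, Units.val_one, one_mul]
  · simp

theorem tupleSign_comm {m k : ℕ} (I J : Fin k → Fin m) : tupleSign I J = tupleSign J I := by
  unfold tupleSign
  refine Fintype.sum_equiv (Equiv.inv _) _ _ fun τ => ?_
  have h : (I = J ∘ ⇑τ⁻¹) ↔ J = I ∘ ⇑((Equiv.inv (Equiv.Perm (Fin k))) τ)⁻¹ := by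
    rw [Equiv.inv_apply, inv_inv]
    constructor
    · rintro rfl
      funext s
      simp
    · rintro rfl
      funext s
      simp
  simp only [h, Equiv.inv_apply, Equiv.Perm.sign_inv]

theorem tupleSign_comp_right {m k : ℕ} (I J : Fin k → Fin m) (α : Equiv.Perm (Fin k)) :
    tupleSign I (J ∘ α) = ((Equiv.Perm.sign α : ℤˣ) : ℤ) * tupleSign I J := by
  rw [tupleSign_comm, tupleSign_comp_left, tupleSign_comm]

/-- Transposing two equal entries fixes the tuple but negates the sign. -/
theorem tupleSign_of_not_injective {m k : ℕ} (I J : Fin k → Fin m)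
    (h : ¬ Function.Injective I) : tupleSign I J = 0 := by
  simp only [Function.Injective, not_forall] at h
  obtain ⟨s, t, hst, hne⟩ := h
  have h1 : I ∘ Equiv.swap s t = I := by
    funext x
    simp only [Function.comp_apply, Equiv.swap_apply_def]
    split_ifs with h1 h2
    · rw [h1, hst]
    · rw [h2, hst]
    · rfl
  have h2 := tupleSign_comp_left I J (Equiv.swap s t)
  rw [h1, Equiv.Perm.sign_swap hne] at h2
  simp only [Units.val_neg, Units.val_one] at h2
  linarith

theorem range_eq_of_tupleSign_ne_zero {m k : ℕ} (I J : Fin k → Fin m) (h : tupleSign I J ≠ 0) :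
    Set.range I = Set.range J := by
  obtain ⟨τ, _, hτ⟩ := Finset.exists_ne_zero_of_sum_ne_zero h
  have : I = J ∘ ⇑τ⁻¹ := by
    by_contra hc
    exact hτ (if_neg hc)
  rw [this, (τ⁻¹).surjective.range_comp]

/-- The product permutation of `Fin (p + q)`. -/
def appendPerm {p q : ℕ} (σ : Equiv.Perm (Fin p)) (τ : Equiv.Perm (Fin q)) :
    Equiv.Perm (Fin (p + q)) :=
  finSumFinEquiv.permCongr (Equiv.Perm.sumCongr σ τ)

theorem sign_appendPerm {p q : ℕ} (σ : Equiv.Perm (Fin p)) (τ : Equiv.Perm (Fin q)) :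
    Equiv.Perm.sign (appendPerm σ τ) = Equiv.Perm.sign σ * Equiv.Perm.sign τ := by
  rw [appendPerm, Equiv.Perm.sign_permCongr, Equiv.Perm.sign_sumCongr]

theorem append_comp_appendPerm {p q : ℕ} {α : Type*} (u : Fin p → α) (v : Fin q → α)
    (σ : Equiv.Perm (Fin p)) (τ : Equiv.Perm (Fin q)) :
    Fin.append (u ∘ σ) (v ∘ τ) = Fin.append u v ∘ appendPerm σ τ := by
  funext s
  induction s using Fin.addCases with
  | left s => simp [appendPerm]
  | right s => simp [appendPerm]

theorem append_comp_left {p q : ℕ} {α : Type*} (u : Fin p → α) (v : Fin q → α)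
    (σ : Equiv.Perm (Fin p)) : Fin.append (u ∘ σ) v = Fin.append u v ∘ appendPerm σ 1 := by
  rw [← append_comp_appendPerm]; rfl

theorem append_comp_right {p q : ℕ} {α : Type*} (u : Fin p → α) (v : Fin q → α)
    (σ : Equiv.Perm (Fin q)) : Fin.append u (v ∘ σ) = Fin.append u v ∘ appendPerm 1 σ := by
  rw [← append_comp_appendPerm]; rfl

theorem not_injective_append_left {p q : ℕ} {α : Type*} (u : Fin p → α) (v : Fin q → α)
    (h : ¬ Function.Injective u) : ¬ Function.Injective (Fin.append u v) := fun hi =>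
  h fun s t hst => Fin.castAdd_injective p q (hi (by simpa using hst))

theorem not_injective_append_right {p q : ℕ} {α : Type*} (u : Fin p → α) (v : Fin q → α)
    (h : ¬ Function.Injective v) : ¬ Function.Injective (Fin.append u v) := fun hi =>
  h fun s t hst => Fin.natAdd_injective q p (hi (by simpa using hst))

theorem sum_append {n p q : ℕ} {M : Type*} [AddCommMonoid M] (f : (Fin (p + q) → Fin n) → M) :
    ∑ i, f i = ∑ u : Fin p → Fin n, ∑ v : Fin q → Fin n, f (Fin.append u v) := by
  rw [← Equiv.sum_comp (Fin.appendEquiv p q), Fintype.sum_prod_type]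
  rfl

variable {n : ℕ} {R : Type*} [CommRing R]

/-- Frees the column tuple from being `i ∘ σ`. Repeated indices cause no trouble, since `tupleSign`
sums over every matching permutation. -/
theorem polTrace_eq_sum_tupleSign {k : ℕ} (M : Fin k → Matrix (Fin n) (Fin n) R) :
    polTrace M = ∑ i : Fin k → Fin n, ∑ j : Fin k → Fin n,
      (tupleSign i j : R) * ∏ s, M s (i s) (j s) := by
  unfold polTrace
  refine Finset.sum_congr rfl fun i _ => ?_
  simp only [tupleSign, Int.cast_sum, Finset.sum_mul]
  rw [Finset.sum_comm]
  refine Finset.sum_congr rfl fun τ _ => ?_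
  rw [Finset.sum_eq_single (i ∘ τ)]
  · rw [if_pos (by funext s; simp)]
    simp
  · intro j _ hj
    rw [if_neg, Int.cast_zero, zero_mul]
    rintro rfl
    exact hj (by funext s; simp)
  · simp

/-- The sign alternates separately in each block of rows and of columns, so each block collapses
from tuples to subsets; p! and q! count the common orderings. -/
theorem polTrace_biSlots_eq (p q : ℕ) (A B : Matrix (Fin n) (Fin n) R) :
    polTrace (biSlots p q A B) = (p ! : R) * (q ! : R) *
      ∑ I₁ : Sub n p, ∑ J₁ : Sub n p, ∑ I₂ : Sub n q, ∑ J₂ : Sub n q,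
        (tupleSign (Fin.append I₁.tuple I₂.tuple) (Fin.append J₁.tuple J₂.tuple) : R) *
          ((A.submatrix I₁.tuple J₁.tuple).det * (B.submatrix I₂.tuple J₂.tuple).det) := by
  have hb : biSlots p q A B = Fin.append (fun _ : Fin p => A) (fun _ : Fin q => B) ∘
      finSumFinEquiv := by
    funext s
    rcases s with s | s <;> simp [biSlots]
  rw [hb, polTrace_comp_equiv, polTrace_eq_sum_tupleSign, sum_append]
  simp only [sum_append (p := p) (q := q), Fin.prod_univ_add, Fin.append_left, Fin.append_right]
  have h1 : ∀ u u' : Fin p → Fin n,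
      ∑ v : Fin q → Fin n, ∑ v' : Fin q → Fin n,
        (tupleSign (Fin.append u v) (Fin.append u' v') : R) *
          ((∏ s, A (u s) (u' s)) * ∏ s, B (v s) (v' s)) =
      ((q ! : R) * ∑ I₂ : Sub n q, ∑ J₂ : Sub n q,
        (tupleSign (Fin.append u I₂.tuple) (Fin.append u' J₂.tuple) : R) *
          (B.submatrix I₂.tuple J₂.tuple).det) * ∏ s, A (u s) (u' s) := by
    intro u u'
    rw [← sum_tuples_prod_eq B
      (fun v v' => (tupleSign (Fin.append u v) (Fin.append u' v') : R)), Finset.sum_mul]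
    · refine Finset.sum_congr rfl fun v _ => ?_
      rw [Finset.sum_mul]
      exact Finset.sum_congr rfl fun v' _ => by ring
    · intro v v' σ
      rw [append_comp_right, tupleSign_comp_left, sign_appendPerm]
      simp
    · intro v v' σ
      rw [append_comp_right, tupleSign_comp_right, sign_appendPerm]
      simp
    · intro v v' h
      rw [tupleSign_of_not_injective _ _ (not_injective_append_right _ _ h), Int.cast_zero]
    · intro v v' h
      rw [tupleSign_comm, tupleSign_of_not_injective _ _ (not_injective_append_right _ _ h),
        Int.cast_zero]
  have h2 : ∑ u : Fin p → Fin n, ∑ v : Fin q → Fin n, ∑ u' : Fin p → Fin n,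
      ∑ v' : Fin q → Fin n, (tupleSign (Fin.append u v) (Fin.append u' v') : R) *
          ((∏ s, A (u s) (u' s)) * ∏ s, B (v s) (v' s)) =
      ∑ u : Fin p → Fin n, ∑ u' : Fin p → Fin n,
      ((q ! : R) * ∑ I₂ : Sub n q, ∑ J₂ : Sub n q,
        (tupleSign (Fin.append u I₂.tuple) (Fin.append u' J₂.tuple) : R) *
          (B.submatrix I₂.tuple J₂.tuple).det) * ∏ s, A (u s) (u' s) := by
    refine Finset.sum_congr rfl fun u _ => ?_
    rw [Finset.sum_comm]
    exact Finset.sum_congr rfl fun u' _ => h1 u u'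
  rw [h2, sum_tuples_prod_eq A (fun u u' => (q ! : R) * ∑ I₂ : Sub n q, ∑ J₂ : Sub n q,
        (tupleSign (Fin.append u I₂.tuple) (Fin.append u' J₂.tuple) : R) *
          (B.submatrix I₂.tuple J₂.tuple).det), mul_assoc]
  · congr 1
    simp only [Finset.mul_sum, Finset.sum_mul]
    refine Finset.sum_congr rfl fun I₁ _ => Finset.sum_congr rfl fun J₁ _ =>
      Finset.sum_congr rfl fun I₂ _ => Finset.sum_congr rfl fun J₂ _ => by ring
  · intro u u' σ
    simp only [append_comp_left, tupleSign_comp_left, sign_appendPerm, Equiv.Perm.sign_one, mul_one,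
      Int.cast_mul, mul_assoc, ← Finset.mul_sum]
    ring
  · intro u u' σ
    simp only [append_comp_left, tupleSign_comp_right, sign_appendPerm, Equiv.Perm.sign_one,
      mul_one, Int.cast_mul, mul_assoc, ← Finset.mul_sum]
    ring
  · intro u u' h
    simp only [tupleSign_of_not_injective _ _ (not_injective_append_left _ _ h), Int.cast_zero,
      zero_mul, Finset.sum_const_zero, mul_zero]
  · intro u u' h
    simp only [fun i j => tupleSign_comm (Fin.append u i) (Fin.append u' j),
      tupleSign_of_not_injective _ _ (not_injective_append_left _ _ h), Int.cast_zero,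
      zero_mul, Finset.sum_const_zero, mul_zero]

/-- The sign vanishes unless the disjointness conditions in the definition of `opF` hold. -/
theorem tupleSign_append_eq_zero {p q : ℕ} (I₁ J₁ : Sub n p) (I₂ J₂ : Sub n q)
    (h : ¬ (Disjoint I₁.1 I₂.1 ∧ Disjoint J₁.1 J₂.1 ∧ I₁.1 ∪ I₂.1 = J₁.1 ∪ J₂.1)) :
    tupleSign (Fin.append I₁.tuple I₂.tuple) (Fin.append J₁.tuple J₂.tuple) = 0 := by
  have hdisj : ∀ (I : Sub n p) (J : Sub n q), Function.Injective (Fin.append I.tuple J.tuple) →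
      Disjoint I.1 J.1 := by
    intro I J hi
    rw [Finset.disjoint_left]
    intro a ha hb
    rw [← Finset.mem_coe, ← Sub.range_tuple] at ha hb
    obtain ⟨s, rfl⟩ := ha
    obtain ⟨t, ht⟩ := hb
    have := @hi (Fin.castAdd q s) (Fin.natAdd p t) (by simp [ht])
    have h2 := congrArg Fin.val this
    simp only [Fin.val_castAdd, Fin.val_natAdd] at h2
    omega
  have hran : ∀ (I : Sub n p) (J : Sub n q), Set.range (Fin.append I.tuple J.tuple) =
      ((I.1 ∪ J.1 : Finset (Fin n)) : Set (Fin n)) := by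
    intro I J
    rw [Finset.coe_union, ← Sub.range_tuple, ← Sub.range_tuple]
    ext a
    constructor
    · rintro ⟨s, rfl⟩
      induction s using Fin.addCases with
      | left s => left; simp
      | right s => right; simp
    · rintro (⟨s, rfl⟩ | ⟨s, rfl⟩)
      · exact ⟨Fin.castAdd q s, by simp⟩
      · exact ⟨Fin.natAdd p s, by simp⟩
  by_contra hne
  refine h ⟨hdisj _ _ ?_, hdisj _ _ ?_, ?_⟩
  · by_contra hi
    exact hne (tupleSign_of_not_injective _ _ hi)
  · by_contra hi
    exact hne (by rw [tupleSign_comm]; exact tupleSign_of_not_injective _ _ hi)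
  · have := range_eq_of_tupleSign_ne_zero _ _ hne
    rw [hran, hran] at this
    exact Finset.coe_injective this

end Tuples

/-! ### The operators `F_{p,q}` and `M_{p,q}` -/

section Operators

/-- Used with `mulOp` and `diffOp`, it makes the operator determinants images of ordinary ones, so
that determinant identities can be proved on symbols. -/
theorem rdet_map {k : ℕ} {A B : Type*} [CommRing A] [Ring B] [Algebra ℂ A] [Algebra ℂ B]
    (f : A →ₐ[ℂ] B) (M : Matrix (Fin k) (Fin k) A) : rdet (M.map f) = f M.det := by
  rw [← Matrix.det_transpose, Matrix.det_apply, map_sum]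
  unfold rdet
  refine Finset.sum_congr rfl fun σ _ => ?_
  rw [Units.smul_def, map_zsmul, ← List.prod_ofFn, map_list_prod, List.map_ofFn]
  rfl

variable (n r : ℕ)

theorem rdet_opX (q : ℕ) (u : Fin q → Fin n) (v : Fin q → Fin r) :
    rdet ((opX n r).submatrix u v) =
      mulOp n r (Matrix.of fun s t => (MvPolynomial.X (u s, v t) : PolyMat n r)).det := by
  rw [← rdet_map]
  rfl

theorem rdet_opD (q : ℕ) (u : Fin q → Fin n) (v : Fin q → Fin r) :
    rdet ((opD n r).submatrix u v) =
      diffOp n r (Matrix.of fun s t => (MvPolynomial.X (u s, v t) : PolyMat n r)).det := by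
  rw [← rdet_map]
  congr 1
  ext1 s t
  exact (diffOp_X n r (u s) (v t)).symm

/-- Cauchy–Binet produces the sum over R. Row indices of Z go to ξ and column indices to x, as I₂
goes to D and J₂ to X in `opF`. -/
theorem det_matXi_mul_matX (q : ℕ) (u v : Fin q → Fin n) :
    ((matXi n r * (matX n r).transpose).submatrix u v).det = ∑ K : Sub r q,
      symX n r (Matrix.of fun s t => (MvPolynomial.X (v s, K.tuple t) : PolyMat n r)).det *
        symXi n r (Matrix.of fun s t => (MvPolynomial.X (u s, K.tuple t) : PolyMat n r)).det := by
  have h : (matXi n r * (matX n r).transpose).submatrix u v =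
      (matXi n r).submatrix u id * ((matX n r).submatrix v id).transpose := by
    ext1 s t
    simp [Matrix.mul_apply]
  rw [h, det_mul_eq_sum_subsets]
  refine Finset.sum_congr rfl fun K _ => ?_
  rw [AlgHom.map_det, AlgHom.map_det, mul_comm, ← Matrix.det_transpose]
  rfl

theorem toOp_symF (p q : ℕ) :
    toOp n r (symF n r p q) = ((p ! : ℂ) * (q ! : ℂ)) • opF n r p q := by
  have hc : ∀ w : Symb n r, ((p ! : Symb n r) * (q ! : Symb n r)) * w =
      ((p ! : ℂ) * (q ! : ℂ)) • w := fun w => by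
    rw [Algebra.smul_def]; simp
  rw [symF, polTrace_biSlots_eq, hc, map_smul]
  congr 1
  unfold opF
  simp only [map_sum]
  refine Finset.sum_congr rfl fun I₁ _ => Finset.sum_congr rfl fun J₁ _ =>
    Finset.sum_congr rfl fun I₂ _ => Finset.sum_congr rfl fun J₂ _ => ?_
  split_ifs with h
  swap
  · rw [tupleSign_append_eq_zero I₁ J₁ I₂ J₂ h, Int.cast_zero, zero_mul, map_zero]
  rw [← zsmul_eq_mul, map_zsmul]
  congr 1
  have hY : ((matY n r).submatrix I₁.tuple J₁.tuple).det =
      symY n r ((genY n).submatrix I₁.tuple J₁.tuple).det := by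
    rw [AlgHom.map_det]
    rfl
  rw [hY, det_matXi_mul_matX, Finset.mul_sum, map_sum, TensorProduct.tmul_sum]
  refine Finset.sum_congr rfl fun K _ => ?_
  rw [toOp_prod, rdet_opX, rdet_opD]

/-- This is `kirillovWei_symF` divided by (p+1)! q!, the normalization in `toOp_symF`. -/
theorem kirillovWei_opF (p q : ℕ) :
    kirillovWei (repL n r) (opF n r (p + 1) q) =
      (q + 1 : ℂ) • opF n r p (q + 1) + (-(q * (n - p - q)) : ℂ) • opF n r p q := by
  have h := kirillovWei_symF n r p q
  simp only [toOp_symF, map_smul, smul_smul, smul_add] at h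
  have h0 : (((p + 1)! : ℂ) * (q ! : ℂ)) ≠ 0 :=
    mul_ne_zero (by exact_mod_cast Nat.factorial_ne_zero _)
      (by exact_mod_cast Nat.factorial_ne_zero _)
  apply smul_right_injective _ h0
  simp only [h, smul_add, smul_smul]
  rw [Nat.factorial_succ, Nat.factorial_succ]
  push_cast
  congr 2 <;> ring

/-- In the basis of wedges of standard vectors, the diagonal entries of Λ^k Y are the principal
minors. -/
theorem c_eq_sum_minors (k : ℕ) :
    c n k = ∑ K : Sub n k, ((genY n).submatrix K.tuple K.tuple).det := by
  classical
  let b := (Pi.basisFun (PolyGL n) (Fin n)).exteriorPower k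
  unfold c
  rw [LinearMap.trace_eq_matrix_trace _ b, Matrix.trace]
  refine Fintype.sum_equiv (M := PolyGL n) (ι := Set.powersetCard (Fin n) k) (κ := Sub n k)
    (Equiv.refl (Sub n k)) _ _ fun K => ?_
  rw [Matrix.diag_apply, LinearMap.toMatrix_apply]
  simp only [b, exteriorPower.basis_repr_apply, exteriorPower.basis_apply,
    exteriorPower.map_apply_ιMulti_family]
  rw [exteriorPower.ιMulti_family, exteriorPower.ιMultiDual_apply_ιMulti, ← Matrix.det_transpose]
  congr 1
  ext1 s t
  simp only [Matrix.transpose_apply, Matrix.of_apply, Function.comp_apply, Pi.basisFun_apply,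
    Matrix.toLin'_apply, Matrix.mulVec_single_one, Module.Basis.coord_apply, Pi.basisFun_repr]
  rfl

theorem tupleSign_self {m k : ℕ} (u : Fin k → Fin m) (h : Function.Injective u) :
    tupleSign u u = 1 := by
  unfold tupleSign
  rw [Finset.sum_eq_single 1]
  · simp
  · intro τ _ hτ
    rw [if_neg]
    intro hu
    refine hτ (inv_eq_one.mp (Equiv.ext fun s => ?_))
    exact (h (congrFun hu s)).symm
  · simp

instance uniqueSubZero (m : ℕ) : Unique (Sub m 0) where
  default := ⟨∅, rfl⟩
  uniq I := Subtype.ext (Finset.card_eq_zero.mp I.2)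

/-- Base of the recursion: an empty second block forces I₁ = J₁, with sign 1. -/
theorem opF_zero_right (k : ℕ) : opF n r k 0 = c n k ⊗ₜ[ℂ] 1 := by
  unfold opF
  rw [c_eq_sum_minors, TensorProduct.sum_tmul]
  refine Finset.sum_congr rfl fun I _ => ?_
  have he : (default : Sub n 0).1 = ∅ := rfl
  simp only [Fintype.sum_unique, he, Finset.disjoint_empty_right, Finset.union_empty, true_and]
  have hr : ∀ {A : Type} [Ring A] (M : Matrix (Fin 0) (Fin 0) A), rdet M = 1 := by
    intro A _ M
    simp [rdet]
  rw [Finset.sum_eq_single I]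
  · rw [if_pos rfl, tupleSign_self, one_smul, hr, hr, mul_one]
    intro s t hst
    induction s using Fin.addCases with
    | left s =>
      induction t using Fin.addCases with
      | left t =>
        simp only [Fin.append_left] at hst
        rw [I.tuple_injective hst]
      | right t => exact t.elim0
    | right s => exact s.elim0
  · intro J _ hJ
    rw [if_neg fun h => hJ (Subtype.ext h.symm)]
  · simp

/-! ### Stirling coefficients and the triangular change of generators. -/

/-- The coefficient of `F_{p,l}` in `M_{p,q}`. -/
def stirlingCoeff (p q l : ℕ) : ℂ :=
  (-1 : ℂ) ^ (q - l) * ((q - l)! : ℂ) * (l ! : ℂ) * (Nat.stirlingSecond q l : ℂ) *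
    (Nat.choose (n - p - l) (q - l) : ℂ)

theorem stirlingCoeff_self (p q : ℕ) : stirlingCoeff n p q q = q ! := by
  simp [stirlingCoeff, Nat.stirlingSecond_self]

theorem stirlingCoeff_succ_zero (p q : ℕ) : stirlingCoeff n p (q + 1) 0 = 0 := by
  simp [stirlingCoeff]

/-- The two terms of the Stirling recurrence match the two terms of `kirillovWei_opF`; the second
also needs the absorption identity for binomial coefficients. -/
theorem stirlingCoeff_recursion (p q l : ℕ) (hl : l + 1 ≤ q) (h : p + 1 + q ≤ n) :
    stirlingCoeff n p (q + 1) (l + 1) = (l + 1 : ℂ) * stirlingCoeff n (p + 1) q l +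
      (-((l + 1 : ℂ) * (n - p - (l + 1)))) * stirlingCoeff n (p + 1) q (l + 1) := by
  -- With d = q - (l+1) and e = n - (p+1+q), every truncated subtraction becomes an honest sum.
  obtain ⟨d, rfl⟩ := Nat.exists_eq_add_of_le hl
  obtain ⟨e, rfl⟩ := Nat.exists_eq_add_of_le h
  unfold stirlingCoeff
  have e1 : l + 1 + d + 1 - (l + 1) = d + 1 := by omega
  have e2 : l + 1 + d - l = d + 1 := by omega
  have e3 : l + 1 + d - (l + 1) = d := by omega
  have e4 : p + 1 + (l + 1 + d) + e - p - (l + 1) = d + e + 1 := by omega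
  have e5 : p + 1 + (l + 1 + d) + e - (p + 1) - l = d + e + 1 := by omega
  have e6 : p + 1 + (l + 1 + d) + e - (p + 1) - (l + 1) = d + e := by omega
  rw [e1, e2, e3, e4, e5, e6, Nat.stirlingSecond_succ_succ, Nat.factorial_succ,
    Nat.factorial_succ l]
  have hc : ((d + e + 1 : ℕ) : ℂ) * ((d + e).choose d : ℂ) =
      ((d + e + 1).choose (d + 1) : ℂ) * ((d + 1 : ℕ) : ℂ) := by
    exact_mod_cast Nat.add_one_mul_choose_eq (d + e) d
  push_cast at hc ⊢
  linear_combination ((l + 1 : ℂ) * (-1) ^ d * (d ! : ℂ) * ((l + 1) * (l ! : ℂ)) *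
    (Nat.stirlingSecond (l + 1 + d) (l + 1) : ℂ)) * hc

theorem opM_succ (p q : ℕ) :
    opM (repL n r) p (q + 1) = kirillovWei (repL n r) (opM (repL n r) (p + 1) q) := by
  unfold opM
  rw [pow_succ', Module.End.mul_apply, show p + (q + 1) = p + 1 + q by omega]

/-- Induction on q with p free, because 𝐃 trades (p+1, q) for (p, q+1) and preserves the bound by n.
-/
theorem opM_eq_sum (p q : ℕ) (h : p + q ≤ n) :
    opM (repL n r) p q = ∑ l ∈ Finset.range (q + 1), stirlingCoeff n p q l • opF n r p l := by
  induction q generalizing p with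
  | zero => simp [opM, opF_zero_right, stirlingCoeff]
  | succ q ih =>
    rw [opM_succ, ih (p + 1) (by omega), map_sum]
    simp only [map_smul, kirillovWei_opF, smul_add, Finset.sum_add_distrib, smul_smul]
    -- Both ends are split off: at l = 0 the coefficient and the correction vanish, and the top term
    -- l = q+1 receives only the raising term, outside the range of `stirlingCoeff_recursion`.
    rw [Finset.sum_range_succ' _ (q + 1), stirlingCoeff_succ_zero, zero_smul, add_zero,
      Finset.sum_range_succ' (fun l => (stirlingCoeff n (p + 1) q l *
        (-(l * (n - p - l)) : ℂ)) • opF n r p l), Finset.sum_range_succ, Finset.sum_range_succ]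
    have h1 : ∀ l ∈ Finset.range q, stirlingCoeff n p (q + 1) (l + 1) • opF n r p (l + 1) =
        (stirlingCoeff n (p + 1) q l * (l + 1 : ℂ)) • opF n r p (l + 1) +
          (stirlingCoeff n (p + 1) q (l + 1) * (-(((l + 1 : ℕ) : ℂ) * (n - p - (l + 1 : ℕ))))) •
            opF n r p (l + 1) := by
      intro l hl
      rw [stirlingCoeff_recursion n p q l (Finset.mem_range.mp hl) (by omega)]
      rw [← add_smul]
      congr 1
      push_cast
      ring
    rw [Finset.sum_congr rfl h1, Finset.sum_add_distrib, stirlingCoeff_self, stirlingCoeff_self,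
      Nat.factorial_succ]
    simp only [Nat.cast_zero, zero_mul, mul_zero, neg_zero, zero_smul, add_zero]
    push_cast
    rw [mul_comm (q + 1 : ℂ)]
    abel

theorem _root_.Subalgebra.mem_of_add_smul_mem {k A : Type*} [Field k] [Semiring A] [Algebra k A]
    (B : Subalgebra k A) {a : k} (ha : a ≠ 0) {x y : A} (hy : y ∈ B) (h : y + a • x ∈ B) :
    x ∈ B := by
  have : x = a⁻¹ • (y + a • x) + (-a⁻¹) • y := by
    rw [smul_add, inv_smul_smul₀ ha, add_right_comm, ← add_smul, add_neg_cancel, zero_smul,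
      zero_add]
  rw [this]
  exact B.add_mem (B.smul_mem h _) (B.smul_mem hy _)

/-- For fixed p the expansion of M in F is triangular with diagonal q! ≠ 0, so F_{p,q} is recovered
by strong induction on q. -/
theorem bigAlgebra_eq_adjoin_opF : bigAlgebra (repL n r) =
    Algebra.adjoin ℂ {F | ∃ p q : ℕ, p + q ≤ n ∧ F = opF n r p q} := by
  apply le_antisymm
  · refine Algebra.adjoin_le ?_
    rintro _ ⟨p, q, h, rfl⟩
    rw [opM_eq_sum n r p q h]
    refine Subalgebra.sum_mem _ fun l hl => Subalgebra.smul_mem _ (Algebra.subset_adjoin ?_) _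
    have := Finset.mem_range.mp hl
    exact ⟨p, l, by omega, rfl⟩
  · refine Algebra.adjoin_le ?_
    rintro _ ⟨p, q, h, rfl⟩
    induction q using Nat.strong_induction_on with
    | _ q ih =>
      have hM : opM (repL n r) p q ∈ bigAlgebra (repL n r) :=
        Algebra.subset_adjoin ⟨p, q, h, rfl⟩
      rw [opM_eq_sum n r p q h, Finset.sum_range_succ, stirlingCoeff_self] at hM
      have h0 : (q ! : ℂ) ≠ 0 := by exact_mod_cast Nat.factorial_ne_zero q
      refine Subalgebra.mem_of_add_smul_mem _ h0 (Subalgebra.sum_mem _ fun l hl => ?_) hM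
      have hl' := Finset.mem_range.mp hl
      exact Subalgebra.smul_mem _ (ih l hl' (by omega)) _

end Operators

/-! ### Invariance -/

section Invariance

/-- The chain rule for polynomial substitutions. -/
theorem pderiv_aeval {σ τ k : Type*} [Fintype σ] [CommRing k] (f : σ → MvPolynomial τ k) (t : τ)
    (p : MvPolynomial σ k) :
    MvPolynomial.pderiv t (MvPolynomial.aeval f p) =
      ∑ s, MvPolynomial.aeval f (MvPolynomial.pderiv s p) * MvPolynomial.pderiv t (f s) := by
  classical
  induction p using MvPolynomial.induction_on with
  | C z => simp
  | add p q hp hq => simp only [map_add, hp, hq, add_mul, Finset.sum_add_distrib]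
  | mul_X p s hp =>
    have h : ∀ u, MvPolynomial.aeval f (MvPolynomial.pderiv u (p * MvPolynomial.X s)) =
        f s * MvPolynomial.aeval f (MvPolynomial.pderiv u p) +
          if u = s then MvPolynomial.aeval f p else 0 := by
      intro u
      rw [Derivation.leibniz, MvPolynomial.pderiv_X, smul_eq_mul, smul_eq_mul, map_add, map_mul,
        map_mul, MvPolynomial.aeval_X, add_comm]
      by_cases hu : u = s
      · simp [hu]
      · simp [hu, Ne.symm hu]
    simp only [h]
    simp only [map_mul, MvPolynomial.aeval_X, Derivation.leibniz, hp, smul_eq_mul, add_mul,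
      Finset.sum_add_distrib, Finset.mul_sum, ite_mul, zero_mul, Finset.sum_ite_eq',
      Finset.mem_univ, if_true, mul_assoc]
    rw [add_comm]

variable {n : ℕ}

/-- As coefficients of det(1 + tM), the sums of minors visibly inherit conjugation invariance. -/
theorem sum_minors_eq_coeff {R : Type*} [CommRing R] (M : Matrix (Fin n) (Fin n) R) (k : ℕ) :
    ∑ K : Sub n k, (M.submatrix K.tuple K.tuple).det =
      (Matrix.det (1 + (Polynomial.X : Polynomial R) • M.map Polynomial.C)).coeff k := by
  rw [Matrix.coeff_det_one_add_X_smul_eq_sum_minors,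
    Finset.sum_subtype (p := fun I : Finset (Fin n) => I.card = k) _ (by simp)]
  refine Finset.sum_congr rfl fun K _ => ?_
  rw [← Matrix.det_submatrix_equiv_self (K.1.orderIsoOfFin K.2).toEquiv]
  rfl

/-- The sum of the principal minors of size `k` is invariant under conjugation. -/
theorem sum_minors_units_conj {R : Type*} [CommRing R] (G : (Matrix (Fin n) (Fin n) R)ˣ)
    (M : Matrix (Fin n) (Fin n) R) (k : ℕ) :
    ∑ K : Sub n k, ((G.val * M * G⁻¹.val).submatrix K.tuple K.tuple).det =
      ∑ K : Sub n k, (M.submatrix K.tuple K.tuple).det := by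
  rw [sum_minors_eq_coeff, sum_minors_eq_coeff]
  congr 1
  let H : (Matrix (Fin n) (Fin n) (Polynomial R))ˣ :=
    Units.map (RingHom.mapMatrix (Polynomial.C : R →+* Polynomial R)).toMonoidHom G
  have h3 : G.val.map Polynomial.C = H.val := rfl
  have h4 : G⁻¹.val.map Polynomial.C = H⁻¹.val := rfl
  have h2 : 1 + (Polynomial.X : Polynomial R) • (G.val * M * G⁻¹.val).map Polynomial.C =
      H.val * (1 + (Polynomial.X : Polynomial R) • M.map Polynomial.C) * H⁻¹.val := by
    rw [Matrix.map_mul, Matrix.map_mul, h3, h4, mul_add, add_mul, mul_one, Units.mul_inv,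
      mul_smul_comm, smul_mul_assoc]
  rw [h2, Matrix.det_units_conj]

theorem compAd_c (g : GL (Fin n) ℂ) (k : ℕ) : compAd g (c n k) = c n k := by
  let G : (Matrix (Fin n) (Fin n) (PolyGL n))ˣ :=
    Units.map (RingHom.mapMatrix (MvPolynomial.C : ℂ →+* PolyGL n)).toMonoidHom g
  have hY : (genY n).map (compAd g) = G.val * genY n * G⁻¹.val := by
    ext1 i j
    rw [Matrix.map_apply, genY, Matrix.of_apply, compAd, MvPolynomial.aeval_X]
    rfl
  have h1 : compAd g (c n k) =
      ∑ K : Sub n k, (((genY n).map (compAd g)).submatrix K.tuple K.tuple).det := by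
    rw [c_eq_sum_minors, map_sum]
    refine Finset.sum_congr rfl fun K _ => ?_
    rw [AlgHom.map_det]
    rfl
  rw [h1, hY, sum_minors_units_conj, c_eq_sum_minors]

variable (n) in
/-- Derivatives of the substitution `Y ↦ g Y g⁻¹`. -/
theorem pderiv_compAd (g : GL (Fin n) ℂ) (l k : Fin n) (f : PolyGL n) :
    MvPolynomial.pderiv (l, k) (compAd g f) =
      ∑ j, ∑ i, ((g : Matrix (Fin n) (Fin n) ℂ) j l *
        ((g⁻¹ : GL (Fin n) ℂ) : Matrix (Fin n) (Fin n) ℂ) k i) •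
          compAd g (MvPolynomial.pderiv (j, i) f) := by
  rw [compAd, pderiv_aeval, Fintype.sum_prod_type]
  refine Finset.sum_congr rfl fun j _ => Finset.sum_congr rfl fun i _ => ?_
  rw [MvPolynomial.smul_eq_C_mul, mul_comm]
  congr 1
  simp only [genY, Matrix.mul_apply, Matrix.map_apply, Matrix.of_apply, Finset.sum_mul, map_sum,
    Derivation.leibniz, MvPolynomial.pderiv_C,
    MvPolynomial.pderiv_X, smul_eq_mul, map_mul]
  rw [Finset.sum_eq_single k, Finset.sum_eq_single l]
  · simp [mul_comm]
  · intro b _ hb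
    rw [Pi.single_eq_of_ne (by simp [hb])]
    simp
  · simp
  · intro b _ hb
    refine Finset.sum_eq_zero fun a _ => ?_
    rw [Pi.single_eq_of_ne (by simp [hb])]
    simp
  · simp

theorem kirillovWei_apply {V : Type*} [AddCommGroup V] [Module ℂ V]
    (π : Matrix (Fin n) (Fin n) ℂ →ₗ[ℂ] Module.End ℂ V) (F : PolyGL n ⊗[ℂ] Module.End ℂ V) :
    kirillovWei π F = ∑ i, ∑ j, TensorProduct.map
      (MvPolynomial.pderiv (j, i) : Derivation ℂ (PolyGL n) (PolyGL n)).toLinearMap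
      (LinearMap.mulRight ℂ (π (Matrix.single i j 1))) F := by
  simp [kirillovWei, LinearMap.sum_apply]

/-- The Kirillov--Wei operator preserves the Kirillov algebra when `π` is equivariant. -/
theorem kirillovWei_mem_kirillovAlgebra {V : Type*} [AddCommGroup V] [Module ℂ V]
    (ρ : Representation ℂ (GL (Fin n) ℂ) V)
    (π : Matrix (Fin n) (Fin n) ℂ →ₗ[ℂ] Module.End ℂ V)
    (hπ : ∀ g k l, conjEnd ρ g (π (Matrix.single k l 1)) =
      ∑ i, ∑ j, ((g : Matrix (Fin n) (Fin n) ℂ) i k *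
        ((g⁻¹ : GL (Fin n) ℂ) : Matrix (Fin n) (Fin n) ℂ) l j) • π (Matrix.single i j 1))
    {F : PolyGL n ⊗[ℂ] Module.End ℂ V} (hF : F ∈ kirillovAlgebra ρ) :
    kirillovWei π F ∈ kirillovAlgebra ρ := by
  simp only [kirillovAlgebra, Algebra.mem_iInf, AlgHom.mem_equalizer] at hF ⊢
  intro g
  let D : Fin n → Fin n → PolyGL n →ₗ[ℂ] PolyGL n := fun j i =>
    (MvPolynomial.pderiv (j, i) : Derivation ℂ (PolyGL n) (PolyGL n)).toLinearMap
  let A := Algebra.TensorProduct.map (compAd g) (AlgHom.id ℂ (Module.End ℂ V))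
  let B := Algebra.TensorProduct.map (AlgHom.id ℂ (PolyGL n)) (conjEnd ρ g)
  let a := (g : Matrix (Fin n) (Fin n) ℂ)
  let b := ((g⁻¹ : GL (Fin n) ℂ) : Matrix (Fin n) (Fin n) ℂ)
  have hba : ∀ i j, ∑ k, a i k * b k j = if i = j then 1 else 0 := by
    intro i j
    have : a * b = 1 := by
      simp only [a, b, ← Units.val_mul, mul_inv_cancel, Units.val_one]
    rw [← Matrix.mul_apply, this, Matrix.one_apply]
  have h1 : ∀ k l (E : PolyGL n ⊗[ℂ] Module.End ℂ V),
      B (TensorProduct.map (D l k) (LinearMap.mulRight ℂ (π (Matrix.single k l 1))) E) =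
      ∑ i, ∑ j, (a i k * b l j) • TensorProduct.map (D l k)
        (LinearMap.mulRight ℂ (π (Matrix.single i j 1))) (B E) := by
    intro k l E
    induction E using TensorProduct.induction_on with
    | zero => simp
    | add x y hx hy => simp only [map_add, hx, hy, smul_add, Finset.sum_add_distrib]
    | tmul s T =>
      simp only [B, TensorProduct.map_tmul, Algebra.TensorProduct.map_tmul, AlgHom.id_apply,
        LinearMap.mulRight_apply, map_mul, hπ, Finset.mul_sum, TensorProduct.tmul_sum,
        mul_smul_comm, TensorProduct.tmul_smul, a, b]
  have h2 : ∀ k l i j (E : PolyGL n ⊗[ℂ] Module.End ℂ V),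
      TensorProduct.map (D l k) (LinearMap.mulRight ℂ (π (Matrix.single i j 1))) (A E) =
      ∑ j', ∑ i', (a j' l * b k i') • A (TensorProduct.map (D j' i')
        (LinearMap.mulRight ℂ (π (Matrix.single i j 1))) E) := by
    intro k l i j E
    induction E using TensorProduct.induction_on with
    | zero => simp
    | add x y hx hy => simp only [map_add, hx, hy, smul_add, Finset.sum_add_distrib]
    | tmul s T =>
      simp only [A, D, TensorProduct.map_tmul, Algebra.TensorProduct.map_tmul, AlgHom.id_apply,
        LinearMap.mulRight_apply, Derivation.coeFn_coe, pderiv_compAd, TensorProduct.sum_tmul,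
        TensorProduct.smul_tmul', a, b]
  change A _ = B _
  rw [kirillovWei_apply, map_sum, map_sum]
  have hAB : B F = A F := (hF g).symm
  simp only [map_sum]
  have h3 : ∀ k l, B (TensorProduct.map (D l k)
      (LinearMap.mulRight ℂ (π (Matrix.single k l 1))) F) =
      ∑ i, ∑ j, ∑ j', ∑ i', ((a i k * b k i') * (a j' l * b l j)) •
        A (TensorProduct.map (D j' i') (LinearMap.mulRight ℂ (π (Matrix.single i j 1))) F) := by
    intro k l
    rw [h1, hAB]
    simp only [h2, Finset.smul_sum, smul_smul]
    refine Finset.sum_congr rfl fun i _ => Finset.sum_congr rfl fun j _ =>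
      Finset.sum_congr rfl fun j' _ => Finset.sum_congr rfl fun i' _ => ?_
    congr 1
    ring
  change _ = ∑ k, ∑ l, B (TensorProduct.map (D l k)
      (LinearMap.mulRight ℂ (π (Matrix.single k l 1))) F)
  simp only [h3]
  -- The derivatives and the E_{kl} transform dually: the sums over k and l are entries of g g⁻¹ and
  -- force i' = i and j' = j.
  have h4 : ∀ T : Fin n → Fin n → Fin n → Fin n → PolyGL n ⊗[ℂ] Module.End ℂ V,
      ∑ k, ∑ l, ∑ i, ∑ j, ∑ j', ∑ i', ((a i k * b k i') * (a j' l * b l j)) • T i j j' i' =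
      ∑ i, ∑ j, T i j j i := by
    intro T
    have h5 : ∑ k, ∑ l, ∑ i, ∑ j, ∑ j', ∑ i', ((a i k * b k i') * (a j' l * b l j)) • T i j j' i' =
        ∑ i, ∑ j, ∑ j', ∑ i', ((∑ k, a i k * b k i') * (∑ l, a j' l * b l j)) • T i j j' i' := by
      have hc : ∀ f : Fin n → Fin n → Fin n → Fin n → Fin n → Fin n →
          PolyGL n ⊗[ℂ] Module.End ℂ V, ∑ k, ∑ l, ∑ i, ∑ j, ∑ j', ∑ i', f k l i j j' i' =
            ∑ i, ∑ j, ∑ j', ∑ i', ∑ k, ∑ l, f k l i j j' i' := by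
        intro f
        have h := Finset.sum_comm (s := Finset.univ) (t := Finset.univ)
          (f := fun (x : Fin n × Fin n) (y : Fin n × Fin n × Fin n × Fin n) =>
            f x.1 x.2 y.1 y.2.1 y.2.2.1 y.2.2.2)
        simpa only [Fintype.sum_prod_type] using h
      rw [hc]
      simp only [Finset.sum_mul_sum, Finset.sum_smul]
    rw [h5]
    simp only [hba]
    refine Finset.sum_congr rfl fun i _ => Finset.sum_congr rfl fun j _ => ?_
    simp
  rw [h4]

theorem c_mem_kirillovAlgebra {V : Type*} [AddCommGroup V] [Module ℂ V]
    (ρ : Representation ℂ (GL (Fin n) ℂ) V) (k : ℕ) :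
    c n k ⊗ₜ[ℂ] (1 : Module.End ℂ V) ∈ kirillovAlgebra ρ := by
  simp only [kirillovAlgebra, Algebra.mem_iInf, AlgHom.mem_equalizer]
  intro g
  simp [compAd_c]

theorem bigAlgebra_le_kirillovAlgebra {V : Type*} [AddCommGroup V] [Module ℂ V]
    (ρ : Representation ℂ (GL (Fin n) ℂ) V)
    (π : Matrix (Fin n) (Fin n) ℂ →ₗ[ℂ] Module.End ℂ V)
    (hπ : ∀ g k l, conjEnd ρ g (π (Matrix.single k l 1)) =
      ∑ i, ∑ j, ((g : Matrix (Fin n) (Fin n) ℂ) i k *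
        ((g⁻¹ : GL (Fin n) ℂ) : Matrix (Fin n) (Fin n) ℂ) l j) • π (Matrix.single i j 1)) :
    bigAlgebra π ≤ kirillovAlgebra ρ := by
  refine Algebra.adjoin_le ?_
  rintro _ ⟨p, q, -, rfl⟩
  unfold opM
  -- Freezes the degree, so that induction on the power of 𝐃 does not change the starting c_k.
  generalize p + q = k
  induction q with
  | zero => exact c_mem_kirillovAlgebra ρ k
  | succ q ih =>
    rw [pow_succ', Module.End.mul_apply]
    exact kirillovWei_mem_kirillovAlgebra ρ π hπ ih

variable (r : ℕ)

theorem repGL_mul_opX (g : GL (Fin n) ℂ) (k : Fin n) (a : Fin r) :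
    repGL n r g * opX n r k a =
      (∑ i, (g : Matrix (Fin n) (Fin n) ℂ) i k • opX n r i a) * repGL n r g := by
  refine LinearMap.ext fun P => ?_
  simp only [Module.End.mul_apply, opX_apply, LinearMap.sum_apply, LinearMap.smul_apply]
  change substT r _ _ = ∑ i, _ • (_ * substT r _ _)
  rw [map_mul, substT, MvPolynomial.aeval_X, Finset.sum_mul]
  refine Finset.sum_congr rfl fun i _ => ?_
  rw [MvPolynomial.smul_eq_C_mul, mul_assoc]

theorem opD_mul_repGL (h : GL (Fin n) ℂ) (l : Fin n) (a : Fin r) :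
    opD n r l a * repGL n r h =
      repGL n r h * ∑ j, (h : Matrix (Fin n) (Fin n) ℂ) l j • opD n r j a := by
  refine LinearMap.ext fun P => ?_
  simp only [Module.End.mul_apply, opD_apply, LinearMap.sum_apply, LinearMap.smul_apply]
  change MvPolynomial.pderiv _ (substT r _ _) = substT r _ _
  rw [substT, pderiv_aeval, Fintype.sum_prod_type, map_sum]
  refine Finset.sum_congr rfl fun j _ => ?_
  simp only [map_sum, Derivation.leibniz, MvPolynomial.pderiv_C,
    MvPolynomial.pderiv_X, smul_eq_mul]
  rw [Finset.sum_eq_single a, Finset.sum_eq_single l]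
  · rw [Pi.single_eq_same, map_smul, MvPolynomial.smul_eq_C_mul]
    ring
  · intro b _ hb
    rw [Pi.single_eq_of_ne (by simp [hb])]
    simp
  · simp
  · intro b _ hb
    rw [Finset.sum_eq_zero, mul_zero]
    intro d _
    rw [Pi.single_eq_of_ne (by simp [hb])]
    simp
  · simp

/-- The x_{iα} transform by g and, by the chain rule, the ∂_{iα} by g⁻¹, so their contraction over α
transforms by the adjoint action. This is the hypothesis of `bigAlgebra_le_kirillovAlgebra`. -/
theorem conjEnd_repGL_repL (g : GL (Fin n) ℂ) (k l : Fin n) :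
    conjEnd (repGL n r) g (repL n r (Matrix.single k l 1)) =
      ∑ i, ∑ j, ((g : Matrix (Fin n) (Fin n) ℂ) i k *
        ((g⁻¹ : GL (Fin n) ℂ) : Matrix (Fin n) (Fin n) ℂ) l j) •
          repL n r (Matrix.single i j 1) := by
  have hg : repGL n r g * repGL n r g⁻¹ = 1 := by simp [← map_mul]
  have hX : ∀ T : Module.End ℂ (PolyMat n r),
      conjEnd (repGL n r) g T = repGL n r g * T * repGL n r g⁻¹ := by
    intro T
    simp [conjEnd, mul_assoc]
  rw [repL_single, hX, Finset.mul_sum, Finset.sum_mul]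
  simp only [repL_single, Finset.smul_sum]
  have h : ∀ a, repGL n r g * (opX n r k a * opD n r l a) * repGL n r g⁻¹ =
      ∑ i, ∑ j, ((g : Matrix (Fin n) (Fin n) ℂ) i k *
        ((g⁻¹ : GL (Fin n) ℂ) : Matrix (Fin n) (Fin n) ℂ) l j) •
          (opX n r i a * opD n r j a) := by
    intro a
    rw [← mul_assoc, repGL_mul_opX, mul_assoc, opD_mul_repGL, mul_assoc, ← mul_assoc (repGL n r g),
      hg, one_mul, Finset.sum_mul_sum]
    simp only [smul_mul_smul_comm]
  rw [Finset.sum_congr rfl fun a _ => h a, Finset.sum_comm]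
  exact Finset.sum_congr rfl fun i _ => Finset.sum_comm

end Invariance

end BigAlg

end

theorem corollary3 (n r : ℕ) :
    BigAlg.bigAlgebra (BigAlg.repL n r) ≤ BigAlg.kirillovAlgebra (BigAlg.repGL n r) ∧
    BigAlg.bigAlgebra (BigAlg.repL n r) =
      Algebra.adjoin ℂ {F | ∃ p q : ℕ, p + q ≤ n ∧ F = BigAlg.opF n r p q} ∧
    ∀ p q : ℕ, p + q ≤ n →
      BigAlg.opM (BigAlg.repL n r) p q =
        ∑ l ∈ Finset.range (q + 1),
          ((-1 : ℂ) ^ (q - l) * ((q - l)! : ℂ) * (l ! : ℂ) * (Nat.stirlingSecond q l : ℂ) *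
            (Nat.choose (n - p - l) (q - l) : ℂ)) • BigAlg.opF n r p l :=
  ⟨BigAlg.bigAlgebra_le_kirillovAlgebra _ _ (BigAlg.conjEnd_repGL_repL r),
    BigAlg.bigAlgebra_eq_adjoin_opF n r, fun p q h => BigAlg.opM_eq_sum n r p q h⟩
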